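/- Let $k$ be a field of characteristic $p>0$, let $S=k[[x_1,\dots,x_m]]$, let $I\subsetneq S$ be an ideal generated by squarefree monomials, let $R=S/I$ (a complete Stanley–Reisner ring), and let $E_R$ be an injective hull of the residue field of $R$. Let $\mathcal F(E_R)=\bigoplus_{e\ge 0}\mathcal F^e(E_R)$ be the Frobenius algebra of $E_R$, where $\mathcal F^e(E_R)$ is the group of additive maps $\varphi:E_R\to E_R$ with $\varphi(rm)=r^{p^e}\varphi(m)$ for $r\in R$, $m\in E_R$, and the product is composition. For an $\mathbb N$-graded ring $A=\bigoplus_{e\ge0}A_e$ whose pieces $A_e$ are finitely generated left $A_0$-modules, let $G_e$ be the subring generated by the homogeneous elements of degree $\le e$ (with $G_{-1}=0$), and let $c_e(A)$ be the minimal number of generators of the left $A_0$-module $A_e/(G_{e-1})_e$. The complexity sequence of $A$ is $\{c_e(A)\}_{e\ge0}$, its generating function is $\mathcal G_A(T)=\sum_{e\ge0}c_e(A)T^e$, and its complexity is $\operatorname{cx}(A)=\inf\{n\in\mathbb R_{\ge0} : c_e(A)=O(n^e)\}\in[0,\infty]$. The Frobenius complexity of $R$ is $\operatorname{cx}_F(R)=\log_p\operatorname{cx}(\mathcal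 F(E_R))\in[-\infty,\infty]$. Write $I^{[p]}$ for the ideal generated by the $p$-th powers of the elements of $I$, and let $U\subseteq\{1,\dots,m\}$ be the set of indices of the variables that occur in the minimal monomial generators of $I$. Let $J_p\subseteq S$ be the ideal generated by the monomials $x_1^{c_1}\cdots x_m^{c_m}$ in $(I^{[p]}:_S I)$ with all $c_i\in\{0,p-1,p\}$ that do not belong to $I^{[p]}+\big((\prod_{i\in U}x_i)^{p-1}\big)$, and let $\mu$ be the minimal number of generators of $J_p$. Suppose that $\mathcal F(E_R)$ is not finitely generated as a ring over $\mathcal F^0(E_R)$. Then every $\mathcal F^e(E_R)$ is a finitely generated left $\mathcal F^0(E_R)$-module, the complexity sequence of $\mathcal F(E_R)$ is $$c_0=1,\qquad c_1=\mu+1,\qquad c_e=\mu\quad(e\ge2),$$ its generating function is $$\mathcal G_{\mathcal F(E_R)}(T)=\frac{1+\mu T-T^2}{1-T},$$ and $\operatorname{cx}(\mathcal F(E_R))=1$ and $\operatorname{cx}_F(R)=0$. -/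

import Mathlib

open scoped DirectSum ENNReal NNReal

universe u

/-! ### Complexity of an `ℕ`-graded ring

The homogeneous pieces are `A 0, A 1, …`, the graded ring is `⨁ e, A e`. -/

namespace GradedComplexity

section

variable (A : ℕ → Type*) [∀ e, AddCommGroup (A e)] [DirectSum.GRing A]

/-- `A` is finitely generated as a ring over its degree zero piece `A 0`. -/
def IsFinitelyGenerated : Prop :=
  ∃ s : Set (⨁ e, A e), s.Finite ∧
    Subring.closure (Set.range (DirectSum.of A 0) ∪ s) = ⊤

/-- Each `A e` is a finitely generated left module over `A 0`. -/
def IsDegreewiseFinite : Prop := ∀ e, Module.Finite (A 0) (A e)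

/-- `G e`: the subring of `⨁ e, A e` generated by the homogeneous elements of degree `≤ e`. -/
def G (e : ℕ) : Subring (⨁ i, A i) :=
  Subring.closure {x | ∃ i ≤ e, x ∈ Set.range (DirectSum.of A i)}

/-- The degree `e + 1` piece of `G e`, as a left `A 0`-submodule of `A (e + 1)`. -/
def decomposableSucc (e : ℕ) : Submodule (A 0) (A (e + 1)) where
  carrier := {x | DirectSum.of A (e + 1) x ∈ G A e}
  zero_mem' := by simp [zero_mem]
  add_mem' {x y} hx hy := by
    simp only [Set.mem_ofPred_eq, map_add] at *
    exact add_mem hx hy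
  smul_mem' a x hx := by
    simp only [Set.mem_ofPred_eq, DirectSum.of_zero_smul] at *
    exact mul_mem (Subring.subset_closure ⟨0, Nat.zero_le e, a, rfl⟩) hx

/-- The degree `e` piece of `G (e - 1)`, where nothing is decomposable in degree zero
(that is, `G (-1)` is taken to be zero, so that the complexity sequence starts with the number of
generators of `A 0` over itself). -/
def decomposable : (e : ℕ) → Submodule (A 0) (A e)
  | 0 => ⊥
  | e + 1 => decomposableSucc A e

/-- The complexity sequence: `c e` is the minimal number of generators of
`A e / (G (e - 1))_e` as a left `A 0`-module (meaningful for degreewise finite `A`). -/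
noncomputable def complexitySeq (e : ℕ) : ℕ :=
  (⊤ : Submodule (A 0) (A e ⧸ decomposable A e)).spanFinrank

/-- The generating function `∑ c e T ^ e` of the graded ring. -/
noncomputable def generatingFunction : PowerSeries ℚ :=
  PowerSeries.mk fun e => (complexitySeq A e : ℚ)

/-- The complexity `inf {n ≥ 0 | c e = O(n ^ e)}`, equal to `∞` if there is no such `n`. -/
noncomputable def complexity : ℝ≥0∞ :=
  sInf {r : ℝ≥0∞ | ∃ n : ℝ≥0, r = n ∧
    (fun e : ℕ => (complexitySeq A e : ℝ)) =O[Filter.atTop] fun e : ℕ => (n : ℝ) ^ e}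

end

end GradedComplexity

/-! ### Frobenius operators -/

section Frobenius

variable (R : Type*) [CommRing R] (p : ℕ) (M : Type*) [AddCommGroup M] [Module R M]

/-- The `p ^ e`-linear maps on `M`: additive `φ : M → M` with `φ (r m) = r ^ (p ^ e) φ m`. -/
def frobeniusOperators (e : ℕ) : AddSubgroup (AddMonoid.End M) where
  carrier := {φ | ∀ (r : R) (m : M), φ (r • m) = r ^ p ^ e • φ m}
  zero_mem' r m := by simp
  add_mem' {φ ψ} hφ hψ r m := by
    change φ (r • m) + ψ (r • m) = r ^ p ^ e • (φ m + ψ m)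
    rw [hφ, hψ, smul_add]
  neg_mem' {φ} hφ r m := by
    change -φ (r • m) = r ^ p ^ e • (-φ m)
    rw [hφ, smul_neg]

/-- Composition of a `p ^ e`-linear and a `p ^ e'`-linear map is `p ^ (e + e')`-linear. -/
instance frobeniusOperators.gradedMonoid : SetLike.GradedMonoid (frobeniusOperators R p M) where
  one_mem r m := by simp
  mul_mem e e' φ ψ hφ hψ r m := by
    change φ (ψ (r • m)) = r ^ p ^ (e + e') • φ (ψ m)
    rw [hψ, hφ, ← pow_mul, ← pow_add, add_comm e' e]

/-- The graded pieces of the Frobenius algebra of `M`; the Frobenius algebra itself is the ring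
`⨁ e, FrobeniusAlgebra R p M e`, whose product is composition. -/
abbrev FrobeniusAlgebra (e : ℕ) : Type _ := frobeniusOperators R p M e

/-- The Frobenius complexity of a local ring `R` of characteristic `p` whose residue field has
injective hull `E`: the logarithm to base `p` of the complexity of the Frobenius algebra of `E`. -/
noncomputable def frobeniusComplexity (E : Type*) [AddCommGroup E] [Module R E] : EReal :=
  ENNReal.log (GradedComplexity.complexity (FrobeniusAlgebra R p E)) / ((Real.log p : ℝ) : EReal)

end Frobenius

/-! ### Injective hulls -/

/-- `ι : M → E` is an injective hull of `M`: an essential extension with `E` injective. -/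
structure IsInjectiveHull {R : Type u} [CommRing R] {M E : Type u} [AddCommGroup M] [Module R M]
    [AddCommGroup E] [Module R E] (ι : M →ₗ[R] E) : Prop where
  injective : Function.Injective ι
  injective_module : Module.Injective R E
  essential : ∀ N : Submodule R E, N ≠ ⊥ → N ⊓ LinearMap.range ι ≠ ⊥

/-- A nonzero quotient of a local ring is local. -/
instance quotientIsLocalRing {A : Type*} [CommRing A] [IsLocalRing A] (I : Ideal A)
    [Nontrivial (A ⧸ I)] : IsLocalRing (A ⧸ I) :=
  IsLocalRing.of_surjective' (Ideal.Quotient.mk I) Ideal.Quotient.mk_surjective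

/-! ### Squarefree monomial ideals in a power series ring -/

section SquarefreeMonomial

variable {k : Type*} [Field k] {m : ℕ}

/-- The squarefree monomial `∏ i ∈ s, x i`. -/
noncomputable def sqfreeMonomial (k : Type*) [Field k] {m : ℕ} (s : Finset (Fin m)) :
    MvPowerSeries (Fin m) k :=
  ∏ i ∈ s, MvPowerSeries.X i

/-- `I` is generated by squarefree monomials. -/
def IsSquarefreeMonomialIdeal (I : Ideal (MvPowerSeries (Fin m) k)) : Prop :=
  ∃ 𝒢 : Set (Finset (Fin m)), I = Ideal.span (sqfreeMonomial k '' 𝒢)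

/-- The ideal generated by the `q`-th powers of the elements of `I`. -/
def bracketPower {A : Type*} [CommRing A] (I : Ideal A) (q : ℕ) : Ideal A :=
  Ideal.span ((fun f => f ^ q) '' (I : Set A))

open Classical in
/-- The variables that occur in the minimal monomial generators of `I`. -/
noncomputable def occurringVars (I : Ideal (MvPowerSeries (Fin m) k)) : Finset (Fin m) :=
  {i | ∃ s : Finset (Fin m), i ∈ s ∧ sqfreeMonomial k s ∈ I ∧ sqfreeMonomial k (s.erase i) ∉ I}

/-- The ideal `J_q`: it is generated by the monomials of `(I^[q] : I)` with all exponents in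
`{0, q - 1, q}` that lie outside `I^[q] + ((∏ x i) ^ (q - 1))`, the product being over the
variables that occur in `I`. -/
noncomputable def idealJ (I : Ideal (MvPowerSeries (Fin m) k)) (q : ℕ) :
    Ideal (MvPowerSeries (Fin m) k) :=
  Ideal.span {f | ∃ c : Fin m →₀ ℕ, f = MvPowerSeries.monomial c (1 : k) ∧
    (∀ i, c i = 0 ∨ c i = q - 1 ∨ c i = q) ∧
    f ∈ (bracketPower I q).colon (I : Set (MvPowerSeries (Fin m) k)) ∧
    f ∉ bracketPower I q ⊔ Ideal.span {sqfreeMonomial k (occurringVars I) ^ (q - 1)}}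

end SquarefreeMonomial

/-! By Matlis duality, E_R is the module of inverse polynomials killed by I. Let Δ be the complex of
squarefree monomials outside I; then E_R has as basis the inverse monomials whose support is a face
of Δ (`mem_annihilatedBy_iff_support`). Every p^e-linear operator on it is a power series f times
the natural Frobenius (`exists_eq_smul_frob`). Such an f has stable exponents and is determined
modulo series with trivial exponents, which is the description of F^e as (I^[q] : I) / I^[q] with q
= p^e. Composition becomes f * g ^ p ^ e, and `PowerSeriesModel` records exactly this information.

Stability and triviality of an exponent vector depend only on its type, which records for each
coordinate whether it is less than q - 1, equal to q - 1, or at least q. The condition on types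
involves Δ alone, not q (`mem_trivialExponents_iff`, `mem_stableExponents_iff`). Hence for every e ≥
1 the minimal generators of F^e over F^0 are indexed by one finite set, the minimal good types. One
of these is the cone type, which gives the (q - 1)-st power of the product of the variables in U.
The remaining "proper" types give, for q = p, the minimal generators of J_p, so there are μ of them
(`spanFinrank_idealJ`).

In degree at least 2 the cone generator is a product of cone generators of lower degree, because (p
- 1) + p (p^n - 1) = p^(n+1) - 1. Generators of proper type never occur in a product of two
operators of positive degree (`add_smul_ne_typeExponent`): the right factor would already have the
same type, which forces the type of the left factor to lie above the cone type. So c_1 = μ + 1 and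
c_e = μ for e ≥ 2. If μ were 0, degrees 0 and 1 would generate the algebra; hence μ ≠ 0 and the
complexity is 1.

Minimality of the generating families comes from coefficients: at a minimal stable exponent, taking
the coefficient is semilinear over the residue map, and these functionals send the generators to a
standard basis (`spanFinrank_top_eq_card`). -/

/-! ### Inverse polynomials -/

section InversePolynomial

open MvPowerSeries Finset

variable {k : Type*} [Field k] {m : ℕ}

/-- The space of inverse polynomials in `m` variables, with `Finsupp.single b 1` standing for the
inverse monomial `x⁻ᵇ`. -/
abbrev InversePolynomial (k : Type*) [Field k] (m : ℕ) : Type _ := (Fin m →₀ ℕ) →₀ k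

namespace InversePolynomial

/-- The pairing of power series with inverse polynomials for which monomials and inverse monomials
are dual to each other. -/
noncomputable def pair (g : MvPowerSeries (Fin m) k) : InversePolynomial k m →ₗ[k] k :=
  Finsupp.linearCombination k fun b => coeff b g

lemma pair_single (g : MvPowerSeries (Fin m) k) (b : Fin m →₀ ℕ) (c : k) :
    pair g (Finsupp.single b c) = coeff b g * c := by
  simp [pair, mul_comm]

lemma pair_add (f g : MvPowerSeries (Fin m) k) (d : InversePolynomial k m) :
    pair (f + g) d = pair f d + pair g d := by
  induction d using Finsupp.induction_linear with
  | zero => simp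
  | add d d' h h' => simp only [map_add, h, h']; ring
  | single b c => simp only [pair_single, map_add, add_mul]

lemma pair_monomial (a : Fin m →₀ ℕ) (d : InversePolynomial k m) :
    pair (monomial a (1 : k)) d = d a := by
  classical
  induction d using Finsupp.induction_linear with
  | zero => simp
  | add d d' h h' => simp only [map_add, h, h', Finsupp.add_apply]
  | single b c => simp [pair_single, coeff_monomial, Finsupp.single_apply]

lemma ext_pair {d d' : InversePolynomial k m} (h : ∀ g, pair g d = pair g d') : d = d' :=
  Finsupp.ext fun a => by rw [← pair_monomial, h, pair_monomial]

/-- The contraction of inverse polynomials by a power series. -/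
noncomputable def contract (f : MvPowerSeries (Fin m) k) :
    InversePolynomial k m →ₗ[k] InversePolynomial k m :=
  Finsupp.linearCombination k fun b =>
    ∑ uv ∈ antidiagonal b, Finsupp.single uv.2 (coeff uv.1 f)

lemma contract_single (f : MvPowerSeries (Fin m) k) (b : Fin m →₀ ℕ) (c : k) :
    contract f (Finsupp.single b c) =
      ∑ uv ∈ antidiagonal b, Finsupp.single uv.2 (coeff uv.1 f * c) := by
  simp [contract, Finset.smul_sum, mul_comm]

lemma pair_contract (g f : MvPowerSeries (Fin m) k) (d : InversePolynomial k m) :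
    pair g (contract f d) = pair (g * f) d := by
  induction d using Finsupp.induction_linear with
  | zero => simp
  | add d d' h h' => simp only [map_add, h, h']
  | single b c =>
    rw [contract_single, map_sum, pair_single, mul_comm g f, coeff_mul, sum_mul]
    exact sum_congr rfl fun uv _ => by rw [pair_single]; ring

noncomputable instance : Module (MvPowerSeries (Fin m) k) (InversePolynomial k m) where
  smul f d := contract f d
  one_smul d := ext_pair fun g => (pair_contract g 1 d).trans (by rw [mul_one])
  mul_smul f f' d := ext_pair fun g => by
    change pair g (contract _ d) = pair g (contract f (contract f' d))
    rw [pair_contract, pair_contract, pair_contract, mul_assoc]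
  smul_zero f := map_zero (contract f)
  smul_add f := map_add (contract f)
  add_smul f f' d := ext_pair fun g => by
    change pair g (contract _ d) = pair g (contract f d + contract f' d)
    rw [map_add, pair_contract, pair_contract, pair_contract, mul_add, pair_add]
  zero_smul d := ext_pair fun g => by
    change pair g (contract 0 d) = _
    rw [pair_contract, mul_zero, map_zero, ← add_right_inj (pair 0 d), ← pair_add, add_zero,
      add_zero]

lemma pair_smul (g f : MvPowerSeries (Fin m) k) (d : InversePolynomial k m) :
    pair g (f • d) = pair (g * f) d := pair_contract g f d

lemma smul_apply (f : MvPowerSeries (Fin m) k) (d : InversePolynomial k m) (a : Fin m →₀ ℕ) :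
    (f • d) a = pair (monomial a 1 * f) d := by
  rw [← pair_monomial, pair_smul]

lemma smul_single_apply (f : MvPowerSeries (Fin m) k) (b : Fin m →₀ ℕ) (c : k) (a : Fin m →₀ ℕ) :
    (f • (Finsupp.single b c : InversePolynomial k m)) a =
      if a ≤ b then coeff (b - a) f * c else 0 := by
  rw [smul_apply, pair_single, coeff_monomial_mul]
  split_ifs <;> simp

lemma monomial_smul_apply (s : Fin m →₀ ℕ) (r : k) (d : InversePolynomial k m)
    (a : Fin m →₀ ℕ) : (monomial s r • d) a = r * d (a + s) := by
  classical
  rw [smul_apply, monomial_mul_monomial, one_mul]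
  induction d using Finsupp.induction_linear with
  | zero => simp
  | add d d' h h' => simp only [map_add, h, h', Finsupp.add_apply, mul_add]
  | single b c => simp [pair_single, coeff_monomial, Finsupp.single_apply]

lemma monomial_smul_single (s b : Fin m →₀ ℕ) (r c : k) (h : s ≤ b) :
    (monomial s r • (Finsupp.single b c : InversePolynomial k m)) =
      Finsupp.single (b - s) (r * c) := by
  classical
  ext a
  rw [smul_single_apply, coeff_monomial, Finsupp.single_apply]
  by_cases ha : a = b - s
  · subst ha
    rw [if_pos tsub_le_self, if_pos (tsub_tsub_cancel_of_le h), if_pos rfl]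
  · rw [if_neg (Ne.symm ha)]
    split_ifs with h1 h2
    · exact absurd (by rw [← h2, tsub_tsub_cancel_of_le h1]) ha
    · simp
    · rfl

lemma monomial_smul_single_of_not_le (s b : Fin m →₀ ℕ) (r c : k) (h : ¬ s ≤ b) :
    (monomial s r • (Finsupp.single b c : InversePolynomial k m)) = 0 := by
  classical
  ext a
  rw [smul_single_apply, coeff_monomial]
  split_ifs with h1 h2
  · exact absurd (h2 ▸ tsub_le_self) h
  · simp
  · rfl

end InversePolynomial

end InversePolynomial

/-! ### Ideals of power series given by their support -/

section SupportIdeal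

open MvPowerSeries Finset

variable {k : Type*} [Field k] {m : ℕ}

/-- The ideal of the power series all of whose exponents lie in the upper set `W`. -/
def supportIdeal (k : Type*) [Field k] {m : ℕ} (W : UpperSet (Fin m →₀ ℕ)) :
    Ideal (MvPowerSeries (Fin m) k) where
  carrier := {f | ∀ j, coeff j f ≠ 0 → j ∈ W}
  zero_mem' j h := absurd (map_zero _) h
  add_mem' {f g} hf hg j h := by
    by_cases h0 : coeff j f = 0
    · exact hg j fun h1 => h (by rw [map_add, h0, h1, add_zero])
    · exact hf j h0
  smul_mem' r f hf j h := by
    rw [smul_eq_mul, coeff_mul] at h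
    obtain ⟨uv, huv, h⟩ := exists_ne_zero_of_sum_ne_zero h
    exact W.upper (le_iff_exists_add'.2 ⟨_, (HasAntidiagonal.mem_antidiagonal.1 huv).symm⟩) (hf _ (right_ne_zero_of_mul h))

lemma monomial_mem_supportIdeal {W : UpperSet (Fin m →₀ ℕ)} {j : Fin m →₀ ℕ} :
    monomial j (1 : k) ∈ supportIdeal k W ↔ j ∈ W := by
  classical
  refine ⟨fun h => h j (by simp), fun h i hi => ?_⟩
  rw [coeff_monomial] at hi
  obtain rfl : i = j := by_contra fun h' => hi (if_neg h')
  exact h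

/-- An ideal of power series given by its support is generated by monomials. -/
lemma supportIdeal_eq_span {W : UpperSet (Fin m →₀ ℕ)} {T : Set (Fin m →₀ ℕ)} (hT : T.Finite)
    (hTW : T ⊆ W) (hW : ∀ j ∈ W, ∃ t ∈ T, t ≤ j) :
    supportIdeal k W = Ideal.span ((fun t => monomial t (1 : k)) '' T) := by
  classical
  refine le_antisymm (fun f hf => ?_) (Ideal.span_le.2 ?_)
  · lift T to Finset (Fin m →₀ ℕ) using hT
    choose! t ht htj using hW
    -- Each exponent j is charged to the single generator `t j`, so `g s` collects the terms charged
    -- to s, divided by the monomial of s, and nothing is counted twice.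
    obtain ⟨g, hg⟩ : ∃ g : (Fin m →₀ ℕ) → MvPowerSeries (Fin m) k,
        ∀ s u, coeff u (g s) = if t (u + s) = s then coeff (u + s) f else 0 :=
      ⟨fun s u => if t (u + s) = s then coeff (u + s) f else 0, fun _ _ => rfl⟩
    have key : f = ∑ s ∈ T, g s * monomial s (1 : k) := by
      ext j
      rw [map_sum]
      simp_rw [coeff_mul_monomial, mul_one, hg]
      by_cases hj : j ∈ W
      · rw [sum_eq_single_of_mem (t j) (ht j hj), if_pos (htj j hj),
          tsub_add_cancel_of_le (htj j hj), if_pos rfl]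
        intro s _ hs
        split_ifs with h h' <;> try rfl
        rw [tsub_add_cancel_of_le h] at h'
        exact absurd h'.symm hs
      · have h0 : coeff j f = 0 := by_contra fun h => hj (hf j h)
        rw [h0, sum_eq_zero]
        intro s _
        split_ifs with h <;> try rfl
        rw [tsub_add_cancel_of_le h, h0]
    rw [key]
    exact sum_mem fun s hs => Ideal.mul_mem_left _ _ (Ideal.subset_span ⟨s, hs, rfl⟩)
  · rintro _ ⟨s, hs, rfl⟩
    exact monomial_mem_supportIdeal.2 (hTW hs)

/-- At a minimal exponent of `W`, a product with a member of the ideal of `W` has the coefficient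
of the member times a constant coefficient. -/
lemma coeff_mul_of_minimal {W : UpperSet (Fin m →₀ ℕ)} {f : MvPowerSeries (Fin m) k}
    (hf : f ∈ supportIdeal k W) (r : MvPowerSeries (Fin m) k) {j : Fin m →₀ ℕ}
    (hj : ∀ i ∈ W, i ≤ j → i = j) : coeff j (r * f) = constantCoeff r * coeff j f := by
  classical
  rw [coeff_mul, sum_eq_single_of_mem (0, j) (by simp)]
  · simp
  · intro uv huv hne
    by_contra h
    have h2 := hj _ (hf _ (right_ne_zero_of_mul h)) (le_iff_exists_add'.2 ⟨_, (HasAntidiagonal.mem_antidiagonal.1 huv).symm⟩)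
    rw [HasAntidiagonal.mem_antidiagonal, h2] at huv
    exact hne (Prod.ext (by simpa using huv) h2)

end SupportIdeal

/-! ### The adic filtration of the power series ring by degree. -/

section AdicFiltration

open MvPowerSeries Finset

variable (k : Type*) [Field k] (m : ℕ)

/-- The ideal generated by the variables. -/
noncomputable def varIdeal : Ideal (MvPowerSeries (Fin m) k) :=
  Ideal.span (Set.range X)

/-- The exponents of degree at least `n`. -/
def degreeGE (n : ℕ) : UpperSet (Fin m →₀ ℕ) where
  carrier := {j | n ≤ j.degree}
  upper' _ _ h h' := le_trans (show n ≤ _ from h') (Finsupp.degree_mono h)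

variable {m}

lemma mem_degreeGE {n : ℕ} {j : Fin m →₀ ℕ} : j ∈ degreeGE m n ↔ n ≤ j.degree := Iff.rfl

lemma monomial_mem_varIdeal_pow (j : Fin m →₀ ℕ) :
    monomial j (1 : k) ∈ varIdeal k m ^ j.degree := by
  induction j using Finsupp.induction_linear with
  | zero => simp
  | add i j hi hj =>
    rw [map_add, pow_add, ← one_mul (1 : k), ← monomial_mul_monomial]
    exact Ideal.mul_mem_mul hi hj
  | single i n =>
    rw [Finsupp.degree_single, ← X_pow_eq]
    exact Ideal.pow_mem_pow (Ideal.subset_span (Set.mem_range_self i)) n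

/-- Degrees add under multiplication, and every exponent of degree at least n lies above one of
degree exactly n, of which there are finitely many. Adic conditions can thus be read off
coefficients. -/
lemma varIdeal_pow (n : ℕ) : varIdeal k m ^ n = supportIdeal k (degreeGE m n) := by
  classical
  apply le_antisymm
  · induction n with
    | zero => exact fun f _ j _ => Nat.zero_le _
    | succ n ih =>
      rw [pow_succ, Ideal.mul_le]
      intro r hr s hs j hj
      have hs' : s ∈ supportIdeal k (degreeGE m 1) := by
        refine Ideal.span_le.2 ?_ hs
        rintro _ ⟨i, rfl⟩
        exact monomial_mem_supportIdeal.2 (by simp [mem_degreeGE])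
      rw [coeff_mul] at hj
      obtain ⟨uv, huv, h⟩ := exists_ne_zero_of_sum_ne_zero hj
      have h1 := ih hr _ (left_ne_zero_of_mul h)
      have h2 := hs' _ (right_ne_zero_of_mul h)
      rw [mem_degreeGE] at *
      rw [← HasAntidiagonal.mem_antidiagonal.1 huv, map_add]
      exact add_le_add h1 h2
  · rw [supportIdeal_eq_span (Finsupp.finite_of_degree_eq n) (fun j hj => ge_of_eq hj)
      (fun j hj => by
        obtain ⟨t, h1, h2⟩ := j.exists_le_degree_eq n hj
        exact ⟨t, h2, h1⟩), Ideal.span_le]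
    rintro _ ⟨t, rfl, rfl⟩
    exact monomial_mem_varIdeal_pow k t

end AdicFiltration

/-! ### Extension of linear maps from ideals, and the Frobenius on inverse polynomials. -/

namespace InversePolynomial

section Injective

open MvPowerSeries Finset

variable {k : Type*} [Field k] {m : ℕ}

lemma exists_varIdeal_pow_smul_eq_zero (d : InversePolynomial k m) :
    ∃ n, ∀ f ∈ varIdeal k m ^ n, f • d = 0 := by
  induction d using Finsupp.induction_linear with
  | zero => exact ⟨0, fun f _ => smul_zero f⟩
  | add d d' h h' =>
    obtain ⟨n, hn⟩ := h
    obtain ⟨n', hn'⟩ := h'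
    refine ⟨n + n', fun f hf => ?_⟩
    rw [smul_add, hn f (Ideal.pow_le_pow_right (Nat.le_add_right n n') hf),
      hn' f (Ideal.pow_le_pow_right (Nat.le_add_left n' n) hf), add_zero]
  | single b c =>
    refine ⟨b.degree + 1, fun f hf => ?_⟩
    rw [varIdeal_pow] at hf
    ext a
    rw [smul_single_apply]
    split_ifs with h
    · have : coeff (b - a) f = 0 := by
        by_contra h0
        have h1 := mem_degreeGE.1 (hf _ h0)
        have h2 := Finsupp.degree_mono (tsub_le_self : b - a ≤ b)
        omega
      rw [this, zero_mul]
      rfl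
    · rfl

lemma exists_varIdeal_pow_smul_eq_zero_of_fg
    (L : Submodule (MvPowerSeries (Fin m) k) (InversePolynomial k m)) (hL : L.FG) :
    ∃ n, ∀ f ∈ varIdeal k m ^ n, ∀ d ∈ L, f • d = 0 := by
  induction L, hL using Submodule.fg_induction with
  | singleton d =>
    obtain ⟨n, hn⟩ := exists_varIdeal_pow_smul_eq_zero d
    refine ⟨n, fun f hf d' hd' => ?_⟩
    obtain ⟨r, rfl⟩ := Submodule.mem_span_singleton.1 hd'
    rw [smul_comm, hn f hf, smul_zero]
  | sup L L' _ _ h h' =>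
    obtain ⟨n, hn⟩ := h
    obtain ⟨n', hn'⟩ := h'
    refine ⟨n + n', fun f hf d hd => ?_⟩
    obtain ⟨a, ha, b, hb, rfl⟩ := Submodule.mem_sup.1 hd
    rw [smul_add, hn f (Ideal.pow_le_pow_right (Nat.le_add_right n n') hf) a ha,
      hn' f (Ideal.pow_le_pow_right (Nat.le_add_left n' n) hf) b hb, add_zero]

/-- A linear functional that kills a power of the ideal of the variables is the pairing with an
inverse polynomial. -/
lemma exists_eq_pair (L : MvPowerSeries (Fin m) k →ₗ[k] k) (n : ℕ)
    (hL : ∀ f ∈ varIdeal k m ^ n, L f = 0) : ∃ d : InversePolynomial k m, ∀ f, L f = pair f d := by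
  classical
  have hfin := Finsupp.finite_of_degree_lt (σ := Fin m) n
  have hsupp : ∀ a : Fin m →₀ ℕ, L (monomial a 1) ≠ 0 → a ∈ hfin.toFinset := by
    intro a ha
    rw [Set.Finite.mem_toFinset, Set.mem_ofPred_eq]
    by_contra h
    exact ha (hL _ (Ideal.pow_le_pow_right (not_lt.1 h) (monomial_mem_varIdeal_pow k a)))
  refine ⟨Finsupp.onFinset hfin.toFinset _ hsupp, fun f => ?_⟩
  have h1 : f - ∑ a ∈ hfin.toFinset, monomial a (coeff a f) ∈ varIdeal k m ^ n := by
    rw [varIdeal_pow]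
    intro j hj
    rw [mem_degreeGE]
    by_contra h
    refine hj ?_
    rw [map_sub, map_sum, sum_eq_single_of_mem j (by simpa using h)]
    · simp
    · intro a _ ha
      rw [coeff_monomial, if_neg (Ne.symm ha)]
  have h2 := hL _ h1
  rw [map_sub, map_sum, sub_eq_zero] at h2
  rw [h2, pair, Finsupp.linearCombination_apply, Finsupp.onFinset_sum _ (by simp)]
  refine sum_congr rfl fun a _ => ?_
  rw [← mul_one (coeff a f), ← smul_eq_mul, map_smul, map_smul]
  simp [mul_comm]

/-- Every linear map from an ideal to the inverse polynomials is multiplication by an element. -/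
theorem exists_forall_eq_smul (𝔞 : Ideal (MvPowerSeries (Fin m) k))
    (φ : 𝔞 →ₗ[MvPowerSeries (Fin m) k] InversePolynomial k m) :
    ∃ d : InversePolynomial k m, ∀ r : 𝔞, φ r = (r : MvPowerSeries (Fin m) k) • d := by
  obtain ⟨N, hN⟩ := exists_varIdeal_pow_smul_eq_zero_of_fg (LinearMap.range φ)
    (by rw [LinearMap.range_eq_map]; exact (Module.Finite.fg_top).map φ)
  -- Artin–Rees: elements of the ideal that lie deep in the adic filtration are combinations, with
  -- coefficients in the N-th power, of elements of the ideal, so φ kills them.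
  obtain ⟨l, hl⟩ := Ideal.exists_pow_inf_eq_pow_smul (varIdeal k m) 𝔞
  have hker : ∀ r (h : r ∈ 𝔞), r ∈ varIdeal k m ^ (N + l) → φ ⟨r, h⟩ = 0 := by
    intro r h hr
    have h1 : r ∈ varIdeal k m ^ (N + l - l) • (varIdeal k m ^ l • ⊤ ⊓ 𝔞) := by
      rw [← hl (N + l) (Nat.le_add_left l N)]
      exact ⟨by simpa using hr, h⟩
    rw [Nat.add_sub_cancel] at h1
    suffices ∃ h : r ∈ 𝔞, φ ⟨r, h⟩ = 0 from this.2
    refine Submodule.smul_induction_on h1 (fun f hf s hs => ?_) fun x y hx hy => ?_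
    · exact ⟨𝔞.mul_mem_left f hs.2, (φ.map_smul f ⟨s, hs.2⟩).trans (hN f hf _ ⟨_, rfl⟩)⟩
    · obtain ⟨hx, hx'⟩ := hx
      obtain ⟨hy, hy'⟩ := hy
      exact ⟨add_mem hx hy, (φ.map_add ⟨x, hx⟩ ⟨y, hy⟩).trans (by rw [hx', hy', add_zero])⟩
  -- Duality turns φ into the scalar functional r ↦ (φ r)(0). It is glued with the zero functional
  -- on a power of the variable ideal and extended by linear algebra, so that the extension is still
  -- continuous and hence a pairing with some d.
  let g : MvPowerSeries (Fin m) k →ₗ.[k] k :=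
    { domain := 𝔞.restrictScalars k
      toFun :=
        { toFun := fun r => φ ⟨r, r.2⟩ 0
          map_add' := fun r s => DFunLike.congr_fun (φ.map_add ⟨r, r.2⟩ ⟨s, s.2⟩) 0
          map_smul' := fun c r => by
            have : (⟨((c • r : 𝔞.restrictScalars k) : MvPowerSeries (Fin m) k), (c • r).2⟩ : 𝔞) =
                (monomial 0 c : MvPowerSeries (Fin m) k) • (⟨r, r.2⟩ : 𝔞) :=
              Subtype.ext (smul_eq_C_mul _ _)
            rw [this, map_smul, monomial_smul_apply]
            simp } }
  let z : MvPowerSeries (Fin m) k →ₗ.[k] k := ⟨(varIdeal k m ^ (N + l)).restrictScalars k, 0⟩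
  have hgz : ∀ (x : g.domain) (y : z.domain), (x : MvPowerSeries (Fin m) k) = y → g x = z y := by
    intro x y hxy
    have := hker x x.2 (hxy ▸ y.2)
    exact DFunLike.congr_fun this 0
  obtain ⟨L, hL⟩ := LinearMap.exists_extend (g.sup z hgz).toFun
  have hL1 : ∀ r (h : r ∈ 𝔞), L r = φ ⟨r, h⟩ 0 := by
    intro r h
    have h1 := (g.left_le_sup z hgz)
    have h2 := h1.2 (x := ⟨r, h⟩) (y := ⟨r, h1.1 h⟩) rfl
    exact (DFunLike.congr_fun hL ⟨r, h1.1 h⟩).trans h2.symm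
  have hL2 : ∀ r ∈ varIdeal k m ^ (N + l), L r = 0 := by
    intro r h
    have h1 := (g.right_le_sup z hgz)
    have h2 := h1.2 (x := ⟨r, h⟩) (y := ⟨r, h1.1 h⟩) rfl
    exact (DFunLike.congr_fun hL ⟨r, h1.1 h⟩).trans h2.symm
  obtain ⟨d, hd⟩ := exists_eq_pair L _ hL2
  refine ⟨d, fun r => ?_⟩
  ext a
  -- The coefficient of φ r at a is the constant one of φ (xᵃ r), so the functional determines φ.
  have h1 := hL1 _ (𝔞.mul_mem_left (monomial a 1) r.2)
  rw [hd, ← smul_apply] at h1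
  rw [h1]
  have h2 := DFunLike.congr_fun (φ.map_smul (monomial a 1) r) 0
  rw [monomial_smul_apply] at h2
  rw [zero_add, one_mul] at h2
  exact h2.symm

end Injective

section Frobenius

open MvPowerSeries Finset

variable {k : Type*} [Field k] {m : ℕ}

/-- The exponent of the inverse monomial that is the `q`-th power of `x⁻ᵇ`, where `x⁻ᵇ` stands
for the class of `(x₁ ⋯ xₘ)⁻¹ x⁻ᵇ` in local cohomology. -/
noncomputable def frobExponent (q : ℕ) (b : Fin m →₀ ℕ) : Fin m →₀ ℕ :=
  Finsupp.equivFunOnFinite.symm fun i => q * b i + (q - 1)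

@[simp] lemma frobExponent_apply (q : ℕ) (b : Fin m →₀ ℕ) (i : Fin m) :
    frobExponent q b i = q * b i + (q - 1) := rfl

variable (p : ℕ) [Fact p.Prime] [CharP k p]

/-- The natural Frobenius operator on inverse polynomials. -/
noncomputable def frob (e : ℕ) : InversePolynomial k m →+ InversePolynomial k m :=
  Finsupp.liftAddHom fun b =>
    (Finsupp.singleAddHom (frobExponent (p ^ e) b)).comp (iterateFrobenius k p e).toAddMonoidHom

lemma frob_single (e : ℕ) (b : Fin m →₀ ℕ) (c : k) :
    frob p e (Finsupp.single b c : InversePolynomial k m) =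
      Finsupp.single (frobExponent (p ^ e) b) (c ^ p ^ e) := by
  rw [frob, Finsupp.liftAddHom_apply_single]
  rfl

/-- In characteristic p, taking the p^e-th power substitutes p^e-th powers for the variables and
applies Frobenius to the coefficients. -/
lemma coeff_smul_pow (e : ℕ) (f : MvPowerSeries (Fin m) k) (u : Fin m →₀ ℕ) :
    coeff (p ^ e • u) (f ^ p ^ e) = coeff u f ^ p ^ e := by
  rw [← map_iterateFrobenius_expand p (NeZero.ne p), coeff_map, coeff_expand_smul,
    iterateFrobenius_def]

lemma exists_eq_smul_of_coeff_pow_ne_zero (e : ℕ) (f : MvPowerSeries (Fin m) k) (j : Fin m →₀ ℕ)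
    (h : coeff j (f ^ p ^ e) ≠ 0) : ∃ u, j = p ^ e • u ∧ coeff u f ≠ 0 := by
  have h1 : ∀ i, p ^ e ∣ j i := by
    by_contra! h'
    obtain ⟨i, hi⟩ := h'
    rw [← map_iterateFrobenius_expand p (NeZero.ne p), coeff_map,
      coeff_expand_of_not_dvd _ _ _ hi, map_zero] at h
    exact h rfl
  have h2 : j = p ^ e • (Finsupp.equivFunOnFinite.symm fun i => j i / p ^ e) := by
    ext i
    simp [Nat.mul_div_cancel' (h1 i)]
  refine ⟨_, h2, fun h0 => h ?_⟩
  rw [h2, coeff_smul_pow, h0, zero_pow (pow_ne_zero _ (NeZero.ne p))]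

lemma frob_smul (e : ℕ) (f : MvPowerSeries (Fin m) k) (d : InversePolynomial k m) :
    frob p e (f • d) = f ^ p ^ e • frob p e d := by
  classical
  have hq : 0 < p ^ e := Nat.pos_of_ne_zero (pow_ne_zero _ (NeZero.ne p))
  induction d using Finsupp.induction_linear with
  | zero => simp
  | add d d' h h' => simp only [smul_add, map_add, h, h']
  | single b c =>
    ext a
    rw [frob_single, smul_single_apply]
    change frob p e (contract f _) a = _
    rw [contract_single, map_sum, Finsupp.finsetSum_apply]
    simp_rw [frob_single, Finsupp.single_apply]
    -- Only exponents a of this form can carry a nonzero coefficient: on the left by construction of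
    -- the Frobenius, on the right because the exponents of a p^e-th power are multiples of p^e.
    by_cases ha : ∃ v ≤ b, frobExponent (p ^ e) v = a
    · obtain ⟨v, hv, rfl⟩ := ha
      have h1 : frobExponent (p ^ e) b - frobExponent (p ^ e) v = p ^ e • (b - v) := by
        ext i
        simp only [Finsupp.tsub_apply, frobExponent_apply, Finsupp.smul_apply, smul_eq_mul,
          Nat.mul_sub]
        omega
      rw [sum_eq_single_of_mem (b - v, v)
        (HasAntidiagonal.mem_antidiagonal.2 (tsub_add_cancel_of_le hv)), if_pos rfl, if_pos, h1,
        coeff_smul_pow, mul_pow]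
      · intro i
        have := Nat.mul_le_mul_left (p ^ e) (hv i)
        simpa using this
      · rintro ⟨u, w⟩ huw hne
        rw [if_neg]
        intro h
        have : w = v := by
          ext i
          have := DFunLike.congr_fun h i
          exact Nat.eq_of_mul_eq_mul_left hq (Nat.add_right_cancel this)
        subst this
        rw [HasAntidiagonal.mem_antidiagonal] at huw
        exact hne (Prod.ext (eq_tsub_of_add_eq huw) rfl)
    · rw [sum_eq_zero, eq_comm]
      · split_ifs with h
        · by_cases h0 : coeff (frobExponent (p ^ e) b - a) (f ^ p ^ e) = 0
          · rw [h0, zero_mul]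
          obtain ⟨u, hu, -⟩ := exists_eq_smul_of_coeff_pow_ne_zero p e f _ h0
          refine absurd ⟨b - u, tsub_le_self, ?_⟩ ha
          ext i
          have h1 := DFunLike.congr_fun hu i
          have h2 := h i
          simp only [Finsupp.tsub_apply, frobExponent_apply, Finsupp.smul_apply, smul_eq_mul] at *
          have h3 : u i ≤ b i := by
            by_contra h'
            have := Nat.mul_le_mul_left (p ^ e) (Nat.succ_le_of_lt (not_le.1 h'))
            rw [Nat.mul_succ] at this
            omega
          rw [Nat.mul_sub]
          have := Nat.mul_le_mul_left (p ^ e) h3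
          omega
        · rfl
      · rintro ⟨u, w⟩ huw
        rw [if_neg]
        intro h
        rw [HasAntidiagonal.mem_antidiagonal] at huw
        exact ha ⟨w, le_iff_exists_add'.2 ⟨u, huw.symm⟩, h⟩

end Frobenius

end InversePolynomial

/-- Two injective hulls of a module are isomorphic. -/
lemma IsInjectiveHull.nonempty_linearEquiv {R : Type u} [CommRing R] {M E D : Type u}
    [AddCommGroup M] [Module R M] [AddCommGroup E] [Module R E] [AddCommGroup D] [Module R D]
    {ι : M →ₗ[R] E} {j : M →ₗ[R] D} (hι : IsInjectiveHull ι) (hj : IsInjectiveHull j) :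
    Nonempty (E ≃ₗ[R] D) := by
  obtain ⟨g, hg⟩ := hj.injective_module.out ι hι.injective j
  have hg_inj : Function.Injective g := by
    rw [← LinearMap.ker_eq_bot]
    by_contra h
    refine hι.essential _ h (eq_bot_iff.2 ?_)
    rintro _ ⟨hx, y, rfl⟩
    have h1 : j y = 0 := (hg y).symm.trans hx
    rw [hj.injective (h1.trans (map_zero j).symm), map_zero]
    exact Submodule.zero_mem _
  -- A retraction h of g is injective by the same essentiality argument, and h ∘ g = id with h
  -- injective makes g surjective.
  obtain ⟨h, hh⟩ := hι.injective_module.out g hg_inj LinearMap.id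
  have hh_inj : Function.Injective h := by
    rw [← LinearMap.ker_eq_bot]
    by_contra h'
    refine hj.essential _ h' (eq_bot_iff.2 ?_)
    rintro _ ⟨hx, y, rfl⟩
    have h1 : h (g (ι y)) = 0 := by rw [hg y]; exact hx
    rw [hh] at h1
    rw [hι.injective ((LinearMap.id_apply (R := R) (ι y)).symm.trans h1 |>.trans (map_zero ι).symm),
      map_zero]
    exact Submodule.zero_mem _
  exact ⟨LinearEquiv.ofBijective g
    ⟨hg_inj, fun d => ⟨h d, hh_inj (hh (h d))⟩⟩⟩

/-! ### The injective hull of the residue field of S/I. -/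

namespace InversePolynomial

open MvPowerSeries

variable {k : Type u} [Field k] {m : ℕ} (I : Ideal (MvPowerSeries (Fin m) k))

/-- The inverse polynomials annihilated by `I`. -/
noncomputable abbrev annihilatedBy : Submodule (MvPowerSeries (Fin m) k) (InversePolynomial k m) :=
  Submodule.torsionBySet (MvPowerSeries (Fin m) k) (InversePolynomial k m) I

variable {I}

lemma mem_annihilatedBy {d : InversePolynomial k m} :
    d ∈ annihilatedBy I ↔ ∀ f ∈ I, f • d = 0 := by
  rw [Submodule.mem_torsionBySet_iff, SetCoe.forall]
  rfl

variable (I)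

/-- Baer's criterion: the ideal is pulled back to the power series ring, where the map is
multiplication by some d. The pullback contains I, on which the map vanishes, so d is itself
annihilated by I. -/
lemma injective_annihilatedBy : Module.Injective (MvPowerSeries (Fin m) k ⧸ I) (annihilatedBy I) := by
  refine Module.Baer.injective fun 𝔞 φ => ?_
  obtain ⟨d, hd⟩ := exists_forall_eq_smul (𝔞.comap (Ideal.Quotient.mk I))
    { toFun := fun r => (φ ⟨Ideal.Quotient.mk I r, r.2⟩ : InversePolynomial k m)
      map_add' := fun r s => congrArg Subtype.val
        (φ.map_add ⟨Ideal.Quotient.mk I r, r.2⟩ ⟨Ideal.Quotient.mk I s, s.2⟩)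
      map_smul' := fun f r => congrArg Subtype.val
        (φ.map_smul (Ideal.Quotient.mk I f) ⟨Ideal.Quotient.mk I r, r.2⟩) }
  have hdI : d ∈ annihilatedBy I := by
    rw [mem_annihilatedBy]
    intro f hf
    have hf0 : Ideal.Quotient.mk I f = 0 := Ideal.Quotient.eq_zero_iff_mem.2 hf
    have h1 : f ∈ 𝔞.comap (Ideal.Quotient.mk I) := by
      rw [Ideal.mem_comap, hf0]
      exact zero_mem _
    rw [← hd ⟨f, h1⟩]
    have h2 : (⟨Ideal.Quotient.mk I f, h1⟩ : 𝔞) = 0 := Subtype.ext hf0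
    change ((φ ⟨Ideal.Quotient.mk I f, h1⟩ : annihilatedBy I) : InversePolynomial k m) = 0
    rw [h2, map_zero]
    rfl
  refine ⟨LinearMap.toSpanSingleton _ _ ⟨d, hdI⟩, fun x hx => ?_⟩
  obtain ⟨f, rfl⟩ := Ideal.Quotient.mk_surjective x
  exact Subtype.ext (hd ⟨f, hx⟩).symm

variable [Nontrivial (MvPowerSeries (Fin m) k ⧸ I)]

lemma constantCoeff_eq_zero_of_mem {f : MvPowerSeries (Fin m) k} (hf : f ∈ I) :
    constantCoeff f = 0 := by
  by_contra h
  have : IsUnit f := isUnit_iff_constantCoeff.2 (isUnit_iff_ne_zero.2 h)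
  exact Ideal.Quotient.nontrivial_iff.1 ‹_› (Ideal.eq_top_of_isUnit_mem I hf this)

lemma smul_single_zero (f : MvPowerSeries (Fin m) k) (c : k) :
    f • (Finsupp.single 0 c : InversePolynomial k m) = Finsupp.single 0 (constantCoeff f * c) := by
  classical
  ext a
  rw [smul_single_apply, Finsupp.single_apply]
  by_cases h : a = 0
  · subst h
    simp
  · rw [if_neg (Ne.symm h), if_neg (fun h' => h (nonpos_iff_eq_zero.1 h'))]

lemma single_zero_mem_annihilatedBy (c : k) :
    (Finsupp.single 0 c : InversePolynomial k m) ∈ annihilatedBy I :=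
  mem_annihilatedBy.2 fun f hf => by
    rw [smul_single_zero, constantCoeff_eq_zero_of_mem I hf, zero_mul, Finsupp.single_zero]

lemma mk_mem_maximalIdeal_iff (f : MvPowerSeries (Fin m) k) :
    Ideal.Quotient.mk I f ∈ IsLocalRing.maximalIdeal (MvPowerSeries (Fin m) k ⧸ I) ↔
      constantCoeff f = 0 := by
  rw [IsLocalRing.mem_maximalIdeal, mem_nonunits_iff, not_iff_comm]
  constructor
  · intro h
    exact (isUnit_iff_constantCoeff.2 (isUnit_iff_ne_zero.2 h)).map (Ideal.Quotient.mk I)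
  · intro h h0
    obtain ⟨y, hy⟩ := h.exists_right_inv
    obtain ⟨g, rfl⟩ := Ideal.Quotient.mk_surjective y
    rw [← map_mul, ← map_one (Ideal.Quotient.mk I), Ideal.Quotient.eq] at hy
    have := constantCoeff_eq_zero_of_mem I hy
    simp [h0] at this

/-- The embedding of the residue field into the inverse polynomials annihilated by `I`. -/
noncomputable def residueEmbedding :
    IsLocalRing.ResidueField (MvPowerSeries (Fin m) k ⧸ I)
      →ₗ[MvPowerSeries (Fin m) k ⧸ I] annihilatedBy I :=
  Submodule.liftQ (IsLocalRing.maximalIdeal (MvPowerSeries (Fin m) k ⧸ I))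
    (LinearMap.toSpanSingleton _ _
      (⟨Finsupp.single 0 1, single_zero_mem_annihilatedBy I 1⟩ : annihilatedBy I)) (by
    intro x hx
    obtain ⟨f, rfl⟩ := Ideal.Quotient.mk_surjective x
    rw [mk_mem_maximalIdeal_iff] at hx
    refine Subtype.ext ((smul_single_zero f 1).trans ?_)
    rw [hx, zero_mul, Finsupp.single_zero]
    rfl)

lemma residueEmbedding_mk (f : MvPowerSeries (Fin m) k) :
    (residueEmbedding I (IsLocalRing.residue _ (Ideal.Quotient.mk I f)) : InversePolynomial k m) =
      Finsupp.single 0 (constantCoeff f) := by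
  refine (smul_single_zero f 1).trans ?_
  rw [mul_one]

lemma isInjectiveHull_residueEmbedding : IsInjectiveHull (residueEmbedding I) where
  injective := by
    rw [← LinearMap.ker_eq_bot, LinearMap.ker_eq_bot']
    intro x hx
    obtain ⟨y, rfl⟩ := IsLocalRing.residue_surjective x
    obtain ⟨f, rfl⟩ := Ideal.Quotient.mk_surjective y
    have h := residueEmbedding_mk I f
    rw [hx, ZeroMemClass.coe_zero, eq_comm, Finsupp.single_eq_zero] at h
    rwa [IsLocalRing.residue_eq_zero_iff, mk_mem_maximalIdeal_iff]
  injective_module := injective_annihilatedBy I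
  essential N hN h := by
    obtain ⟨d, hdN, hd0⟩ := Submodule.exists_mem_ne_zero_of_ne_bot hN
    have hne : (d : InversePolynomial k m).support.Nonempty :=
      Finsupp.support_nonempty_iff.2 fun h => hd0 (Subtype.ext h)
    obtain ⟨a, ha, hmax⟩ := Finset.exists_maximal hne
    -- Contraction by a maximal exponent of the support leaves only the constant inverse monomial,
    -- which spans the image of the residue field.
    have h1 : monomial a (1 : k) • (d : InversePolynomial k m) =
        Finsupp.single 0 ((d : InversePolynomial k m) a) := by
      classical
      ext c
      rw [monomial_smul_apply, one_mul, Finsupp.single_apply]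
      split_ifs with hc
      · rw [← hc, zero_add]
      · by_contra h'
        have h2 := hmax (Finsupp.mem_support_iff.2 h') le_add_self
        exact hc ((add_eq_right.1 (le_antisymm h2 le_add_self)).symm)
    have h2 : Ideal.Quotient.mk I (monomial a (1 : k)) • d ∈
        N ⊓ LinearMap.range (residueEmbedding I) := by
      refine ⟨N.smul_mem _ hdN, IsLocalRing.residue _ (Ideal.Quotient.mk I
        (C ((d : InversePolynomial k m) a))), Subtype.ext ?_⟩
      rw [residueEmbedding_mk, constantCoeff_C]
      exact h1.symm
    rw [h, Submodule.mem_bot] at h2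
    have h3 := h1.symm.trans (congrArg Subtype.val h2)
    rw [ZeroMemClass.coe_zero, Finsupp.single_eq_zero] at h3
    exact Finsupp.mem_support_iff.1 ha h3

end InversePolynomial

/-! ### Exponents attached to a simplicial complex -/

section Exponents

variable {m : ℕ} (Δ : LowerSet (Finset (Fin m)))

/-- The exponents whose support is not a face of `Δ`. -/
def nonfaceExponents : UpperSet (Fin m →₀ ℕ) where
  carrier := {j | j.support ∉ Δ}
  upper' _ _ h h' := fun h'' => (show _ ∉ Δ from h') (Δ.lower (Finsupp.support_mono h) h'')

/-- The exponents `j` such that `xʲ` times the `q`-power Frobenius vanishes on the inverse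
polynomials supported on `Δ`. -/
def trivialExponents (q : ℕ) : UpperSet (Fin m →₀ ℕ) where
  carrier := {j | ∀ b a : Fin m →₀ ℕ, b.support ∈ Δ →
    j + a ≠ InversePolynomial.frobExponent q b}
  upper' j j' h h' b a hb hab := by
    refine h' b (j' - j + a) hb ?_
    rw [← add_assoc, add_tsub_cancel_of_le h, hab]

/-- The exponents `j` such that `xʲ` times the `q`-power Frobenius preserves the inverse
polynomials supported on `Δ`. -/
def stableExponents (q : ℕ) : UpperSet (Fin m →₀ ℕ) where
  carrier := {j | ∀ b a : Fin m →₀ ℕ, b.support ∈ Δ → a.support ∉ Δ →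
    j + a ≠ InversePolynomial.frobExponent q b}
  upper' j j' h h' b a hb ha hab := by
    refine h' b (j' - j + a) hb (fun h'' => ha (Δ.lower ?_ h'')) ?_
    · exact Finsupp.support_mono le_add_self
    · rw [← add_assoc, add_tsub_cancel_of_le h, hab]

variable {Δ}

lemma mem_nonfaceExponents {j : Fin m →₀ ℕ} : j ∈ nonfaceExponents Δ ↔ j.support ∉ Δ := Iff.rfl

lemma mem_trivialExponents {q : ℕ} {j : Fin m →₀ ℕ} : j ∈ trivialExponents Δ q ↔
    ∀ b a : Fin m →₀ ℕ, b.support ∈ Δ → j + a ≠ InversePolynomial.frobExponent q b := Iff.rfl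

lemma mem_stableExponents {q : ℕ} {j : Fin m →₀ ℕ} : j ∈ stableExponents Δ q ↔
    ∀ b a : Fin m →₀ ℕ, b.support ∈ Δ → a.support ∉ Δ →
      j + a ≠ InversePolynomial.frobExponent q b := Iff.rfl

end Exponents

/-! ### Frobenius operators as power series times the natural Frobenius. -/

namespace InversePolynomial

open MvPowerSeries

section Annihilated

variable {k : Type u} [Field k] {m : ℕ} {I : Ideal (MvPowerSeries (Fin m) k)}
  {Δ : LowerSet (Finset (Fin m))} (hI : I = supportIdeal k (nonfaceExponents Δ))

include hI

/-- Contraction by x^b extracts the coefficient at b as a constant term. The module is thus spanned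
by inverse monomials, and operators can be tested on them one exponent at a time. -/
lemma mem_annihilatedBy_iff_support {d : InversePolynomial k m} :
    d ∈ annihilatedBy I ↔ ∀ b, d b ≠ 0 → b.support ∈ Δ := by
  rw [mem_annihilatedBy]
  constructor
  · intro h b hb
    by_contra hbΔ
    have h1 : monomial b (1 : k) ∈ I := by
      rw [hI]
      exact monomial_mem_supportIdeal.2 hbΔ
    have h2 := DFunLike.congr_fun (h _ h1) 0
    rw [monomial_smul_apply, zero_add, one_mul] at h2
    exact hb h2
  · intro h f hf
    ext a
    have h1 := I.mul_mem_left (monomial a 1) hf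
    rw [hI] at h1
    rw [smul_apply, pair, Finsupp.linearCombination_apply]
    refine Finset.sum_eq_zero fun b hb => ?_
    have h2 : coeff b (monomial a 1 * f) = 0 := by
      by_contra h0
      exact h1 b h0 (h b (Finsupp.mem_support_iff.1 hb))
    exact (congrArg (d b • ·) h2).trans (smul_zero _)

lemma single_mem_annihilatedBy {b : Fin m →₀ ℕ} (hb : b.support ∈ Δ) (c : k) :
    (Finsupp.single b c : InversePolynomial k m) ∈ annihilatedBy I := by
  classical
  rw [mem_annihilatedBy_iff_support hI]
  intro b' hb'
  rw [Finsupp.single_apply] at hb'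
  obtain rfl : b = b' := by_contra fun h => hb' (if_neg h)
  exact hb

lemma annihilatedBy_induction {P : annihilatedBy I → Prop} (h0 : P 0)
    (hadd : ∀ d d', P d → P d' → P (d + d'))
    (hsingle : ∀ b (hb : b.support ∈ Δ) c, P ⟨Finsupp.single b c, single_mem_annihilatedBy hI hb c⟩)
    (d : annihilatedBy I) : P d := by
  obtain ⟨d, hd⟩ := d
  induction d using Finsupp.induction with
  | zero => exact h0
  | single_add b c d hb hc ih =>
    have hd' := (mem_annihilatedBy_iff_support hI).1 hd
    have hb0 : d b = 0 := Finsupp.notMem_support_iff.1 hb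
    have h1 : d ∈ annihilatedBy I := by
      refine (mem_annihilatedBy_iff_support hI).2 fun b' hb' => hd' b' ?_
      have hne : b ≠ b' := fun h => hb' (h ▸ hb0)
      rwa [Finsupp.add_apply, Finsupp.single_eq_of_ne' hne, zero_add]
    have h2 : b.support ∈ Δ := hd' b (by
      rwa [Finsupp.add_apply, Finsupp.single_eq_same, hb0, add_zero])
    exact hadd _ _ (hsingle b h2 c) (ih h1)

variable (p : ℕ) [Fact p.Prime] [CharP k p] (e : ℕ)

lemma smul_frob_mem_of_mem_stable {f : MvPowerSeries (Fin m) k}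
    (hf : f ∈ supportIdeal k (stableExponents Δ (p ^ e))) (d : annihilatedBy I) :
    f • frob p e (d : InversePolynomial k m) ∈ annihilatedBy I := by
  induction d using annihilatedBy_induction hI with
  | h0 => simp
  | hadd d d' h h' =>
    rw [Submodule.coe_add, map_add, smul_add]
    exact add_mem h h'
  | hsingle b hb c =>
    rw [mem_annihilatedBy_iff_support hI]
    intro a ha
    rw [frob_single, smul_single_apply] at ha
    split_ifs at ha with h
    · by_contra haΔ
      exact hf _ (left_ne_zero_of_mul ha) b a hb haΔ (tsub_add_cancel_of_le h)
    · exact absurd rfl ha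

lemma mem_stable_of_smul_frob_mem {f : MvPowerSeries (Fin m) k}
    (hf : ∀ d : annihilatedBy I, f • frob p e (d : InversePolynomial k m) ∈ annihilatedBy I) :
    f ∈ supportIdeal k (stableExponents Δ (p ^ e)) := by
  intro j hj b a hb ha hab
  refine ha ((mem_annihilatedBy_iff_support hI).1
    (hf ⟨Finsupp.single b 1, single_mem_annihilatedBy hI hb 1⟩) a ?_)
  rw [frob_single, smul_single_apply, ← hab, if_pos le_add_self, add_tsub_cancel_right, one_pow,
    mul_one]
  exact hj

lemma smul_frob_eq_zero_iff {f : MvPowerSeries (Fin m) k} :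
    (∀ d : annihilatedBy I, f • frob p e (d : InversePolynomial k m) = 0) ↔
      f ∈ supportIdeal k (trivialExponents Δ (p ^ e)) := by
  constructor
  · intro hf j hj b a hb hab
    refine hj ?_
    have := DFunLike.congr_fun (hf ⟨Finsupp.single b 1, single_mem_annihilatedBy hI hb 1⟩) a
    rwa [frob_single, smul_single_apply, ← hab, if_pos le_add_self, add_tsub_cancel_right, one_pow,
      mul_one] at this
  · intro hf d
    induction d using annihilatedBy_induction hI with
    | h0 => simp
    | hadd d d' h h' => rw [Submodule.coe_add, map_add, smul_add, h, h', add_zero]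
    | hsingle b hb c =>
      ext a
      rw [frob_single, smul_single_apply]
      split_ifs with h
      · by_contra ha
        exact hf _ (left_ne_zero_of_mul ha) b a hb (tsub_add_cancel_of_le h)
      · rfl

/-- Every Frobenius-linear operator on the inverse polynomials annihilated by `I` is a power series
times the natural Frobenius. -/
theorem exists_eq_smul_frob (ψ : annihilatedBy I →+ annihilatedBy I)
    (hψ : ∀ (f : MvPowerSeries (Fin m) k) d, ψ (f • d) = f ^ p ^ e • ψ d) :
    ∃ f : MvPowerSeries (Fin m) k,
      ∀ d, (ψ d : InversePolynomial k m) = f • frob p e (d : InversePolynomial k m) := by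
  classical
  have hq : 0 < p ^ e := Nat.pos_of_ne_zero (pow_ne_zero _ (NeZero.ne p))
  -- With q = p^e, the exponent j is `frobExponent q (quot j) - rem j`, and `quot j` is the smallest
  -- b for which j ≤ `frobExponent q b`. The coefficient of f at j is therefore forced by the value
  -- of ψ at the inverse monomial of `quot j`. If that monomial is outside the module, j is a
  -- trivial exponent and 0 is a harmless default.
  let quot (j : Fin m →₀ ℕ) : Fin m →₀ ℕ := Finsupp.equivFunOnFinite.symm fun i => j i / p ^ e
  let rem (j : Fin m →₀ ℕ) : Fin m →₀ ℕ :=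
    Finsupp.equivFunOnFinite.symm fun i => p ^ e - 1 - j i % p ^ e
  obtain ⟨f, hf⟩ : ∃ f : MvPowerSeries (Fin m) k, ∀ j, coeff j f =
      if h : (quot j).support ∈ Δ then
        (ψ ⟨Finsupp.single (quot j) 1, single_mem_annihilatedBy hI h 1⟩ : InversePolynomial k m)
          (rem j)
      else 0 := ⟨fun j => if h : (quot j).support ∈ Δ then
        (ψ ⟨Finsupp.single (quot j) 1, single_mem_annihilatedBy hI h 1⟩ : InversePolynomial k m)
          (rem j)
      else 0, fun _ => rfl⟩
  have key : ∀ b (hb : b.support ∈ Δ),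
      (ψ ⟨Finsupp.single b 1, single_mem_annihilatedBy hI hb 1⟩ : InversePolynomial k m) =
        f • frob p e (Finsupp.single b 1) := by
    intro b hb
    have hψmon : ∀ s a : Fin m →₀ ℕ, (ψ (monomial s (1 : k) •
        (⟨Finsupp.single b 1, single_mem_annihilatedBy hI hb 1⟩ : annihilatedBy I)) :
          InversePolynomial k m) a =
        (ψ ⟨Finsupp.single b 1, single_mem_annihilatedBy hI hb 1⟩ : InversePolynomial k m)
          (a + p ^ e • s) := by
      intro s a
      rw [hψ, monomial_pow, one_pow, Submodule.coe_smul, monomial_smul_apply, one_mul]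
    ext a
    rw [frob_single, smul_single_apply, one_pow, mul_one]
    split_ifs with ha
    · rw [hf]
      have hle : quot (frobExponent (p ^ e) b - a) ≤ b := by
        intro i
        change (p ^ e * b i + (p ^ e - 1) - a i) / p ^ e ≤ b i
        rw [← Nat.lt_succ_iff, Nat.div_lt_iff_lt_mul hq, Nat.succ_mul, mul_comm (b i)]
        omega
      have hsupp : (quot (frobExponent (p ^ e) b - a)).support ∈ Δ :=
        Δ.lower (Finsupp.support_mono hle) hb
      rw [dif_pos hsupp]
      -- The inverse monomial used to define this coefficient is a contraction of the one at b, so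
      -- Frobenius-linearity of ψ relates their values.
      have h1 : (⟨Finsupp.single (quot (frobExponent (p ^ e) b - a)) 1,
          single_mem_annihilatedBy hI hsupp 1⟩ : annihilatedBy I) =
          monomial (b - quot (frobExponent (p ^ e) b - a)) (1 : k) •
            ⟨Finsupp.single b 1, single_mem_annihilatedBy hI hb 1⟩ := by
        refine Subtype.ext ?_
        rw [Submodule.coe_smul, monomial_smul_single _ _ _ _ tsub_le_self,
          tsub_tsub_cancel_of_le hle, mul_one]
      rw [h1, hψmon]
      congr 1
      ext i
      have h2 := ha i
      have h3 := Nat.div_add_mod (p ^ e * b i + (p ^ e - 1) - a i) (p ^ e)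
      have h4 := Nat.mod_lt (p ^ e * b i + (p ^ e - 1) - a i) hq
      have h5 := Nat.mul_le_mul_left (p ^ e) (hle i)
      simp only [frobExponent_apply] at h2
      change a i = p ^ e - 1 - (p ^ e * b i + (p ^ e - 1) - a i) % p ^ e +
        p ^ e * (b i - (p ^ e * b i + (p ^ e - 1) - a i) / p ^ e)
      change p ^ e * ((p ^ e * b i + (p ^ e - 1) - a i) / p ^ e) ≤ p ^ e * b i at h5
      rw [Nat.mul_sub]
      omega
    · obtain ⟨i, hi⟩ : ∃ i, ¬ a i ≤ p ^ e * b i + (p ^ e - 1) := by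
        by_contra! h
        exact ha h
      -- A power of x_i just large enough to kill the inverse monomial at b bounds the i-th exponent
      -- in its image under ψ by q (b i + 1) - 1, with q = p^e.
      have h0 : monomial (Finsupp.single i (b i + 1)) (1 : k) •
          (⟨Finsupp.single b 1, single_mem_annihilatedBy hI hb 1⟩ : annihilatedBy I) = 0 := by
        refine Subtype.ext ?_
        rw [Submodule.coe_smul, monomial_smul_single_of_not_le]
        · rfl
        · intro h
          have := h i
          simp at this
      have h1 := hψmon (Finsupp.single i (b i + 1)) (a - p ^ e • Finsupp.single i (b i + 1))
      rw [h0, map_zero, tsub_add_cancel_of_le] at h1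
      · exact h1.symm
      · intro l
        by_cases hl : l = i
        · subst hl
          simp only [Finsupp.smul_apply, Finsupp.single_eq_same, smul_eq_mul, mul_add, mul_one]
          omega
        · simp [Finsupp.single_eq_of_ne hl]
  refine ⟨f, fun d => ?_⟩
  induction d using annihilatedBy_induction hI with
  | h0 => simp
  | hadd d d' h h' => rw [map_add, Submodule.coe_add, Submodule.coe_add, map_add, smul_add, h, h']
  | hsingle b hb c =>
    have h1 : (Finsupp.single b c : InversePolynomial k m) =
        monomial (0 : Fin m →₀ ℕ) c • Finsupp.single b 1 := by
      rw [monomial_smul_single _ _ _ _ fun _ => Nat.zero_le _, tsub_zero, mul_one]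
    have h2 : (⟨Finsupp.single b c, single_mem_annihilatedBy hI hb c⟩ : annihilatedBy I) =
        monomial (0 : Fin m →₀ ℕ) c • ⟨Finsupp.single b 1, single_mem_annihilatedBy hI hb 1⟩ :=
      Subtype.ext h1
    rw [h2, hψ, Submodule.coe_smul, key b hb, Submodule.coe_smul, frob_smul, smul_comm]

end Annihilated

/-! ### Power series representing operators: composition, uniqueness and existence. -/

section Represents

variable {k : Type u} [Field k] {m : ℕ} {I : Ideal (MvPowerSeries (Fin m) k)}
  {E : Type u} [AddCommGroup E] [Module (MvPowerSeries (Fin m) k ⧸ I) E]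
  (w : E ≃ₗ[MvPowerSeries (Fin m) k ⧸ I] annihilatedBy I)
  (p : ℕ) [Fact p.Prime] [CharP k p]

/-- The operator `φ` on `E` is the power series `f` times the `e`-th power of the natural
Frobenius, in terms of an identification of `E` with inverse polynomials. -/
def Represents (e : ℕ) (f : MvPowerSeries (Fin m) k) (φ : AddMonoid.End E) : Prop :=
  ∀ x, (w (φ x) : InversePolynomial k m) = f • frob p e (w x : InversePolynomial k m)

variable {w p} {e e' : ℕ} {f g : MvPowerSeries (Fin m) k} {φ ψ : AddMonoid.End E}

lemma Represents.add (h : Represents w p e f φ) (h' : Represents w p e g ψ) :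
    Represents w p e (f + g) (φ + ψ) := fun x => by
  rw [add_smul, ← h, ← h', ← Submodule.coe_add, ← map_add]
  rfl

/-- ψ acts first, so its series g has to be moved across the e-th Frobenius, which raises it to the
power p^e. -/
lemma Represents.mul (h : Represents w p e f φ) (h' : Represents w p e' g ψ) :
    Represents w p (e + e') (f * g ^ p ^ e) (φ * ψ) := fun x => by
  have hcomp : ∀ d : InversePolynomial k m, frob p e (frob p e' d) = frob p (e + e') d := by
    intro d
    induction d using Finsupp.induction_linear with
    | zero => simp
    | add d d' h h' => simp only [map_add, h, h']
    | single b c =>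
      rw [frob_single, frob_single, frob_single, ← pow_mul, ← pow_add, add_comm e']
      congr 1
      ext i
      have h1 : 0 < p ^ e := Nat.pos_of_ne_zero (pow_ne_zero _ (NeZero.ne p))
      have h2 : 0 < p ^ e' := Nat.pos_of_ne_zero (pow_ne_zero _ (NeZero.ne p))
      obtain ⟨x, hx⟩ := Nat.exists_eq_succ_of_ne_zero h1.ne'
      obtain ⟨y, hy⟩ := Nat.exists_eq_succ_of_ne_zero h2.ne'
      simp only [frobExponent_apply, pow_add, hx, hy, Nat.succ_eq_add_one, Nat.add_sub_cancel]
      have h3 : (x + 1) * (y + 1) - 1 = x * y + x + y :=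
        Nat.sub_eq_of_eq_add (by ring)
      rw [h3]
      ring
  change (w (φ (ψ x)) : InversePolynomial k m) = _
  rw [h, h', frob_smul, hcomp, mul_smul]

lemma Represents.ext (h : Represents w p e f φ) (h' : Represents w p e f ψ) : φ = ψ :=
  AddMonoidHom.ext fun x => w.injective (Subtype.ext ((h x).trans (h' x).symm))

lemma Represents.sub_mem {Δ : LowerSet (Finset (Fin m))}
    (hI : I = supportIdeal k (nonfaceExponents Δ)) (h : Represents w p e f φ)
    (h' : Represents w p e g φ) : f - g ∈ supportIdeal k (trivialExponents Δ (p ^ e)) := by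
  rw [← smul_frob_eq_zero_iff hI p e]
  intro d
  have h1 := h (w.symm d)
  have h2 := h' (w.symm d)
  rw [w.apply_symm_apply] at h1 h2
  rw [sub_smul, ← h1, ← h2, sub_self]

lemma Represents.of_sub_mem {Δ : LowerSet (Finset (Fin m))}
    (hI : I = supportIdeal k (nonfaceExponents Δ)) (h : Represents w p e f φ)
    (hg : f - g ∈ supportIdeal k (trivialExponents Δ (p ^ e))) : Represents w p e g φ := fun x => by
  have h1 := (smul_frob_eq_zero_iff hI p e).2 hg (w x)
  rw [sub_smul, sub_eq_zero] at h1
  rw [h x, h1]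

lemma Represents.mem_stable {Δ : LowerSet (Finset (Fin m))}
    (hI : I = supportIdeal k (nonfaceExponents Δ)) (h : Represents w p e f φ) :
    f ∈ supportIdeal k (stableExponents Δ (p ^ e)) := by
  refine mem_stable_of_smul_frob_mem hI p e fun d => ?_
  have h1 := h (w.symm d)
  rw [w.apply_symm_apply] at h1
  rw [← h1]
  exact Subtype.prop _

variable (w p)

/-- Every Frobenius operator is represented by a power series. -/
lemma exists_represents {Δ : LowerSet (Finset (Fin m))}
    (hI : I = supportIdeal k (nonfaceExponents Δ)) (e : ℕ)
    (φ : frobeniusOperators (MvPowerSeries (Fin m) k ⧸ I) p E e) :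
    ∃ f, Represents w p e f (φ : AddMonoid.End E) := by
  obtain ⟨φ, hφ⟩ := φ
  obtain ⟨f, hf⟩ := exists_eq_smul_frob hI p e
    ((w : E →+ annihilatedBy I).comp
      (AddMonoidHom.comp φ (w.symm : annihilatedBy I →+ E))) (by
        intro f d
        change w (φ (w.symm (Ideal.Quotient.mk I f • d))) = _
        rw [map_smul, hφ, map_smul]
        rfl)
  refine ⟨f, fun x => ?_⟩
  rw [← hf]
  change _ = ((w (φ (w.symm (w x))) : annihilatedBy I) : InversePolynomial k m)
  rw [w.symm_apply_apply]

/-- Every power series with stable exponents represents a Frobenius operator. -/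
lemma exists_operator {Δ : LowerSet (Finset (Fin m))}
    (hI : I = supportIdeal k (nonfaceExponents Δ)) {e : ℕ}
    (hf : f ∈ supportIdeal k (stableExponents Δ (p ^ e))) :
    ∃ φ : frobeniusOperators (MvPowerSeries (Fin m) k ⧸ I) p E e,
      Represents w p e f (φ : AddMonoid.End E) := by
  let ψ : E → E := fun x => w.symm ⟨_, smul_frob_mem_of_mem_stable hI p e hf (w x)⟩
  have hψ : ∀ x, (w (ψ x) : InversePolynomial k m) = f • frob p e (w x : InversePolynomial k m) :=
    fun x => congrArg Subtype.val (w.apply_symm_apply _)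
  refine ⟨⟨(⟨⟨ψ, w.injective (Subtype.ext ?_)⟩, fun x y => w.injective (Subtype.ext ?_)⟩ : E →+ E),
    fun r x => w.injective (Subtype.ext ?_)⟩, hψ⟩
  · rw [hψ]
    simp
  · change (w (ψ (x + y)) : InversePolynomial k m) = (w (ψ x + ψ y) : annihilatedBy I)
    rw [hψ, map_add, map_add, Submodule.coe_add, Submodule.coe_add, map_add, smul_add, hψ, hψ]
  · obtain ⟨r, rfl⟩ := Ideal.Quotient.mk_surjective r
    change (w (ψ (Ideal.Quotient.mk I r • x)) : InversePolynomial k m) =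
      (w ((Ideal.Quotient.mk I r) ^ p ^ e • ψ x) : annihilatedBy I)
    rw [hψ, map_smul, map_smul, ← map_pow, Submodule.torsionBySet.mk_smul,
      Submodule.torsionBySet.mk_smul, Submodule.coe_smul, Submodule.coe_smul, hψ, frob_smul,
      smul_comm]

end Represents

end InversePolynomial

/-! ### Exponent types

The exponents `0`, `q - 1`, `q` are recorded, independently of `q`, by the types `0`, `1`, `2`. -/

section ExponentType

variable {m : ℕ}

/-- The exponents `0`, `q - 1`, `q` belonging to the types `0`, `1`, `2`. -/
def typeValue (q : ℕ) : Fin 3 → ℕ := ![0, q - 1, q]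

/-- The largest type whose exponent is at most `n`. -/
def typeOf (q n : ℕ) : Fin 3 := if q ≤ n then 2 else if n = q - 1 then 1 else 0

/-- An adjunction between types and exponents: divisibility by a monomial of given type becomes an
inequality of types. -/
lemma typeValue_le_iff {q : ℕ} (hq : 2 ≤ q) (x : Fin 3) (n : ℕ) :
    typeValue q x ≤ n ↔ x ≤ typeOf q n := by
  unfold typeOf
  fin_cases x <;> split_ifs <;> simp [typeValue] <;> omega

lemma typeOf_typeValue {q : ℕ} (hq : 2 ≤ q) (x : Fin 3) : typeOf q (typeValue q x) = x := by
  unfold typeOf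
  fin_cases x
  · exact (if_neg (show ¬ q ≤ 0 by omega)).trans (if_neg (show ¬ 0 = q - 1 by omega))
  · exact (if_neg (show ¬ q ≤ q - 1 by omega)).trans (if_pos rfl)
  · exact if_pos le_rfl

lemma typeOf_eq_two_iff {q n : ℕ} : typeOf q n = 2 ↔ q ≤ n := by
  unfold typeOf
  split_ifs <;> simp_all

lemma typeOf_eq_zero_iff {q n : ℕ} (hq : 2 ≤ q) : typeOf q n = 0 ↔ n < q - 1 := by
  unfold typeOf
  split_ifs <;> simp <;> omega

lemma typeOf_eq_one_iff {q n : ℕ} (hq : 2 ≤ q) : typeOf q n = 1 ↔ n = q - 1 := by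
  unfold typeOf
  split_ifs <;> simp <;> omega

/-- The exponent vector of type `τ`. -/
noncomputable def typeExponent (q : ℕ) (τ : Fin m → Fin 3) : Fin m →₀ ℕ :=
  Finsupp.equivFunOnFinite.symm fun i => typeValue q (τ i)

@[simp] lemma typeExponent_apply (q : ℕ) (τ : Fin m → Fin 3) (i : Fin m) :
    typeExponent q τ i = typeValue q (τ i) := rfl

/-- The type of an exponent vector. -/
def exponentType (q : ℕ) (j : Fin m →₀ ℕ) : Fin m → Fin 3 := fun i => typeOf q (j i)

lemma typeExponent_le_iff {q : ℕ} (hq : 2 ≤ q) {τ : Fin m → Fin 3} {j : Fin m →₀ ℕ} :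
    typeExponent q τ ≤ j ↔ τ ≤ exponentType q j :=
  forall_congr' fun i => typeValue_le_iff hq (τ i) (j i)

lemma exponentType_typeExponent {q : ℕ} (hq : 2 ≤ q) (τ : Fin m → Fin 3) :
    exponentType q (typeExponent q τ) = τ :=
  funext fun i => typeOf_typeValue hq (τ i)

/-- The positions at which `τ` takes the value `x`. -/
def typeFiber (x : Fin 3) (τ : Fin m → Fin 3) : Finset (Fin m) := {i | τ i = x}

@[simp] lemma mem_typeFiber {x : Fin 3} {τ : Fin m → Fin 3} {i : Fin m} :
    i ∈ typeFiber x τ ↔ τ i = x := by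
  simp [typeFiber]

variable (Δ : LowerSet (Finset (Fin m)))

/-- The types of the stable exponents that are not trivial. -/
def IsGoodType (τ : Fin m → Fin 3) : Prop :=
  typeFiber 2 τ ∈ Δ ∧ ∀ F ∈ Δ, typeFiber 2 τ ⊆ F → F ∪ typeFiber 0 τ ∈ Δ

open Classical in
/-- The type that vanishes at the cone points of `Δ` and equals one elsewhere. -/
noncomputable def coneType : Fin m → Fin 3 := fun i => if ∀ F ∈ Δ, insert i F ∈ Δ then 0 else 1

open Classical in
/-- The minimal good types. -/
noncomputable def minGoodTypes : Finset (Fin m → Fin 3) := {τ | Minimal (IsGoodType Δ) τ}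

open Classical in
/-- The minimal good types other than the cone type. -/
noncomputable def properTypes : Finset (Fin m → Fin 3) := (minGoodTypes Δ).erase (coneType Δ)

variable {Δ}

lemma mem_minGoodTypes {τ : Fin m → Fin 3} :
    τ ∈ minGoodTypes Δ ↔ Minimal (IsGoodType Δ) τ := by
  simp [minGoodTypes]

lemma mem_properTypes {τ : Fin m → Fin 3} :
    τ ∈ properTypes Δ ↔ τ ≠ coneType Δ ∧ Minimal (IsGoodType Δ) τ := by
  simp [properTypes, mem_minGoodTypes]

lemma coneType_eq_one_iff {i : Fin m} : coneType Δ i = 1 ↔ ∃ F ∈ Δ, insert i F ∉ Δ := by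
  unfold coneType
  split_ifs with h <;> simp <;> simpa using h

lemma typeFiber_two_coneType : typeFiber 2 (coneType Δ) = ∅ := by
  ext i
  simp only [mem_typeFiber, Finset.notMem_empty, iff_false, coneType]
  split_ifs <;> simp

/-- Cone points can be joined to a face one at a time without leaving Δ. -/
lemma isGoodType_coneType (h0 : ∅ ∈ Δ) : IsGoodType Δ (coneType Δ) := by
  rw [IsGoodType, typeFiber_two_coneType]
  refine ⟨h0, fun F hF _ => ?_⟩
  suffices ∀ A ⊆ typeFiber 0 (coneType Δ), F ∪ A ∈ Δ from this _ subset_rfl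
  intro A hA
  induction A using Finset.induction_on with
  | empty => simpa using hF
  | insert i A _ ih =>
    have h1 := hA (Finset.mem_insert_self i A)
    rw [mem_typeFiber, coneType] at h1
    split_ifs at h1 with h2
    · rw [Finset.union_insert]
      exact h2 _ (ih ((Finset.subset_insert i A).trans hA))
    · simp at h1

/-- Without entries 2, goodness concerns all faces, so each position of type 0 can be joined to
every face and is a cone point. -/
lemma IsGoodType.coneType_le {τ : Fin m → Fin 3} (h : IsGoodType Δ τ)
    (hτ : typeFiber 2 τ = ∅) : coneType Δ ≤ τ := by
  intro i
  unfold coneType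
  split_ifs with h1
  · exact Fin.zero_le _
  · by_contra h2
    have h3 : τ i = 0 := by
      revert h2
      generalize τ i = x
      fin_cases x <;> simp
    refine h1 fun F hF => Δ.lower ?_ (h.2 F hF (by simp [hτ]))
    refine Finset.insert_subset_iff.2 ⟨?_, Finset.subset_union_left⟩
    exact Finset.mem_union_right _ (mem_typeFiber.2 h3)

lemma typeFiber_two_mono {σ τ : Fin m → Fin 3} (h : σ ≤ τ) : typeFiber 2 σ ⊆ typeFiber 2 τ := by
  intro i hi
  rw [mem_typeFiber] at *
  have := h i
  rw [hi] at this
  exact le_antisymm (Fin.le_last _) this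

lemma minimal_coneType (h0 : ∅ ∈ Δ) : Minimal (IsGoodType Δ) (coneType Δ) := by
  refine ⟨isGoodType_coneType h0, fun σ hσ h => hσ.coneType_le ?_⟩
  have := typeFiber_two_mono h
  rwa [typeFiber_two_coneType, Finset.subset_empty] at this

lemma coneType_mem_minGoodTypes (h0 : ∅ ∈ Δ) : coneType Δ ∈ minGoodTypes Δ :=
  mem_minGoodTypes.2 (minimal_coneType h0)

lemma exists_minGoodTypes_le {τ : Fin m → Fin 3} (h : IsGoodType Δ τ) :
    ∃ σ ∈ minGoodTypes Δ, σ ≤ τ := by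
  obtain ⟨σ, h1, h2⟩ := (Set.toFinite {τ | IsGoodType Δ τ}).exists_le_minimal h
  exact ⟨σ, mem_minGoodTypes.2 h2, h1⟩

lemma not_coneType_le (h0 : ∅ ∈ Δ) {τ : Fin m → Fin 3} (h : τ ∈ properTypes Δ) :
    ¬ coneType Δ ≤ τ := fun h' =>
  (mem_properTypes.1 h).1 ((mem_properTypes.1 h).2.eq_of_le (isGoodType_coneType h0) h').symm

lemma exists_properTypes_le {τ : Fin m → Fin 3} (h : IsGoodType Δ τ) (h' : ¬ coneType Δ ≤ τ) :
    ∃ σ ∈ properTypes Δ, σ ≤ τ := by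
  obtain ⟨σ, h1, h2⟩ := exists_minGoodTypes_le h
  exact ⟨σ, mem_properTypes.2 ⟨fun h3 => h' (h3 ▸ h2), mem_minGoodTypes.1 h1⟩, h2⟩

open InversePolynomial

/-- The smallest b with j ≤ `frobExponent q b` is the coordinatewise quotient of j by q, and it is
supported where j is at least q. -/
lemma mem_trivialExponents_iff {q : ℕ} (hq : 2 ≤ q) {j : Fin m →₀ ℕ} :
    j ∈ trivialExponents Δ q ↔ typeFiber 2 (exponentType q j) ∉ Δ := by
  rw [mem_trivialExponents]
  constructor
  · intro h h'
    let b : Fin m →₀ ℕ := Finsupp.equivFunOnFinite.symm fun i => j i / q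
    have hle : j ≤ frobExponent q b := fun i => by
      have := Nat.div_add_mod (j i) q
      have := Nat.mod_lt (j i) (show 0 < q by omega)
      change j i ≤ q * (j i / q) + (q - 1)
      omega
    refine h b (frobExponent q b - j) (Δ.lower ?_ h') (add_tsub_cancel_of_le hle)
    intro i hi
    rw [mem_typeFiber, exponentType, typeOf_eq_two_iff]
    by_contra h1
    exact Finsupp.mem_support_iff.1 hi (Nat.div_eq_of_lt (not_le.1 h1))
  · intro h b a hb hab
    refine h (Δ.lower ?_ hb)
    intro i hi
    rw [mem_typeFiber, exponentType, typeOf_eq_two_iff] at hi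
    rw [Finsupp.mem_support_iff]
    intro h0
    have := DFunLike.congr_fun hab i
    simp only [Finsupp.add_apply, frobExponent_apply, h0] at this
    omega

/-- If j + a = `frobExponent q b`, the support F of b contains the positions where j ≥ q. Off F the
sum is q - 1, so a is nonzero there exactly where j < q - 1. Hence the support of a lies in F
together with the positions of type 0, and this bound is attained when b is large on F. -/
lemma mem_stableExponents_iff {q : ℕ} (hq : 2 ≤ q) {j : Fin m →₀ ℕ}
    (hj : j ∉ trivialExponents Δ q) :
    j ∈ stableExponents Δ q ↔ IsGoodType Δ (exponentType q j) := by
  rw [mem_trivialExponents_iff hq, not_not] at hj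
  have h2 : ∀ i, i ∈ typeFiber 2 (exponentType q j) ↔ q ≤ j i := fun i => by
    rw [mem_typeFiber, exponentType, typeOf_eq_two_iff]
  have h0 : ∀ i, i ∈ typeFiber 0 (exponentType q j) ↔ j i < q - 1 := fun i => by
    rw [mem_typeFiber, exponentType, typeOf_eq_zero_iff hq]
  rw [mem_stableExponents]
  constructor
  · refine fun h => ⟨hj, fun F hF hjF => ?_⟩
    classical
    -- The extra 1 makes the difference from j strictly positive on all of F.
    let b : Fin m →₀ ℕ := Finsupp.equivFunOnFinite.symm fun i => if i ∈ F then j i / q + 1 else 0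
    have hb : ∀ i, b i = if i ∈ F then j i / q + 1 else 0 := fun _ => rfl
    have hlt : ∀ i, j i ≤ frobExponent q b i ∧
        (i ∈ F ∪ typeFiber 0 (exponentType q j) → j i < frobExponent q b i) := fun i => by
      rw [frobExponent_apply, hb, Finset.mem_union, h0]
      have h3 := Nat.div_add_mod (j i) q
      have h4 := Nat.mod_lt (j i) (show 0 < q by omega)
      split_ifs with hi
      · rw [mul_add, mul_one]
        omega
      · have : ¬ q ≤ j i := fun h' => hi (hjF ((h2 i).2 h'))
        simp only [hi, false_or]
        omega
    by_contra hcon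
    refine h b (frobExponent q b - j) (Δ.lower ?_ hF) (fun h' => hcon (Δ.lower ?_ h'))
      (add_tsub_cancel_of_le fun i => (hlt i).1)
    · intro i hi
      by_contra h'
      exact Finsupp.mem_support_iff.1 hi (if_neg h')
    · intro i hi
      rw [Finsupp.mem_support_iff, Finsupp.tsub_apply]
      have := (hlt i).2 hi
      omega
  · rintro ⟨-, h⟩ b a hb ha hab
    have hab' : ∀ i, j i + a i = q * b i + (q - 1) := fun i => DFunLike.congr_fun hab i
    refine ha (Δ.lower ?_ (h b.support hb fun i hi => ?_))
    · intro i hi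
      rw [Finset.mem_union, h0, Finsupp.mem_support_iff, or_iff_not_imp_left, not_not]
      intro h3
      have h4 := hab' i
      have h5 := Finsupp.mem_support_iff.1 hi
      rw [h3] at h4
      omega
    · rw [h2] at hi
      rw [Finsupp.mem_support_iff]
      intro h3
      have h4 := hab' i
      rw [h3] at h4
      omega

lemma typeExponent_notMem_trivialExponents {q : ℕ} (hq : 2 ≤ q) {τ : Fin m → Fin 3}
    (h : IsGoodType Δ τ) : typeExponent q τ ∉ trivialExponents Δ q := by
  rw [mem_trivialExponents_iff hq, exponentType_typeExponent hq, not_not]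
  exact h.1

lemma typeExponent_mem_stableExponents {q : ℕ} (hq : 2 ≤ q) {τ : Fin m → Fin 3}
    (h : IsGoodType Δ τ) : typeExponent q τ ∈ stableExponents Δ q := by
  rwa [mem_stableExponents_iff hq (typeExponent_notMem_trivialExponents hq h),
    exponentType_typeExponent hq]

lemma zero_notMem_trivialExponents (h0 : ∅ ∈ Δ) (q : ℕ) : 0 ∉ trivialExponents Δ q := fun h =>
  h 0 (frobExponent q 0) (by simpa using h0) (zero_add _)

/-- The exponents of minimal good types are minimal among the stable exponents. -/
lemma eq_typeExponent_of_le {q : ℕ} (hq : 2 ≤ q) {τ : Fin m → Fin 3} (h : Minimal (IsGoodType Δ) τ)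
    {j : Fin m →₀ ℕ} (hj : j ∈ stableExponents Δ q) (hle : j ≤ typeExponent q τ) :
    j = typeExponent q τ := by
  have h1 : j ∉ trivialExponents Δ q := fun h' =>
    typeExponent_notMem_trivialExponents hq h.1 ((trivialExponents Δ q).upper hle h')
  rw [mem_stableExponents_iff hq h1] at hj
  have h2 : exponentType q j ≤ τ := by
    conv_rhs => rw [← exponentType_typeExponent hq τ]
    exact (typeExponent_le_iff hq).1 (((typeExponent_le_iff hq).2 le_rfl).trans hle)
  exact le_antisymm hle ((typeExponent_le_iff hq).2 (h.2 hj h2))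

/-- The exponents of proper types do not arise in products of operators of positive degree. -/
lemma add_smul_ne_typeExponent (h0 : ∅ ∈ Δ) {q q' : ℕ} (hq : 2 ≤ q) (hq' : 2 ≤ q')
    {τ : Fin m → Fin 3} (h : τ ∈ properTypes Δ) {j j' : Fin m →₀ ℕ}
    (hj : j ∈ stableExponents Δ q) (hj' : j' ∈ stableExponents Δ q') :
    j + q • j' ≠ typeExponent (q * q') τ := by
  intro hsum
  have hτ := (mem_properTypes.1 h).2
  have hsum' : ∀ i, j i + q * j' i = typeValue (q * q') (τ i) := fun i => DFunLike.congr_fun hsum i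
  have hv0 : ∀ n, typeValue n 0 = 0 := fun _ => rfl
  have hv1 : ∀ n, typeValue n 1 = n - 1 := fun _ => rfl
  have hv2 : ∀ n, typeValue n 2 = n := fun _ => rfl
  have hcases : ∀ x : Fin 3, x = 0 ∨ x = 1 ∨ x = 2 := by decide
  have hqq : 2 ≤ q * q' := le_trans hq (Nat.le_mul_of_pos_right q (by omega))
  -- The right factor dominates the sum: where the sum is 0 or q q' - 1, the entry of j' is 0 or
  -- below q' respectively. Minimality of τ then gives equality of types.
  have hle : exponentType q' j' ≤ τ := by
    intro i
    have h1 := hsum' i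
    change typeOf q' (j' i) ≤ τ i
    rcases hcases (τ i) with h2 | h2 | h2 <;> rw [h2] at h1 ⊢
    · rw [hv0] at h1
      have h3 : j' i = 0 := by
        rcases Nat.mul_eq_zero.1 (Nat.eq_zero_of_add_eq_zero h1).2 with h3 | h3 <;> omega
      exact ((typeOf_eq_zero_iff hq').2 (by omega)).le
    · rw [hv1] at h1
      have h3 : j' i < q' := by
        by_contra h3
        have := Nat.mul_le_mul_left q (not_lt.1 h3)
        omega
      rcases hcases (typeOf q' (j' i)) with h4 | h4 | h4 <;> rw [h4]
      · decide
      · rw [typeOf_eq_two_iff] at h4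
        omega
    · exact Fin.le_last _
  have hnt' : j' ∉ trivialExponents Δ q' := by
    rw [mem_trivialExponents_iff hq', not_not]
    exact Δ.lower (typeFiber_two_mono hle) hτ.1.1
  have heq : exponentType q' j' = τ :=
    hτ.eq_of_le ((mem_stableExponents_iff hq' hnt').1 hj') hle
  -- Knowing the type of j' determines j: it is q - 1 where τ is 1 and 0 elsewhere. In particular it
  -- has no entry of type 2, so it lies above the cone type.
  have hj1 : exponentType q j ≤ τ ∧ typeFiber 2 (exponentType q j) = ∅ := by
    have key : ∀ i, typeOf q (j i) ≤ τ i ∧ typeOf q (j i) ≠ 2 := by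
      intro i
      have h1 := hsum' i
      have h2 : typeOf q' (j' i) = τ i := congrFun heq i
      rcases hcases (τ i) with h3 | h3 | h3 <;> rw [h3] at h1 h2 ⊢
      · rw [hv0] at h1
        have h4 : typeOf q (j i) = 0 := (typeOf_eq_zero_iff hq).2 (by omega)
        rw [h4]
        decide
      · rw [hv1] at h1
        rw [typeOf_eq_one_iff hq'] at h2
        have h4 : typeOf q (j i) = 1 := by
          rw [typeOf_eq_one_iff hq]
          rw [h2, Nat.mul_sub, mul_one] at h1
          have := Nat.mul_le_mul_left q (show 1 ≤ q' by omega)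
          omega
        rw [h4]
        decide
      · rw [hv2] at h1
        rw [typeOf_eq_two_iff] at h2
        have := Nat.mul_le_mul_left q h2
        have h4 : typeOf q (j i) = 0 := (typeOf_eq_zero_iff hq).2 (by omega)
        rw [h4]
        decide
    refine ⟨fun i => (key i).1, Finset.eq_empty_of_forall_notMem fun i hi => ?_⟩
    exact (key i).2 ((mem_typeFiber (τ := exponentType q j)).1 hi)
  have hnt : j ∉ trivialExponents Δ q := by
    rw [mem_trivialExponents_iff hq, not_not, hj1.2]
    exact h0
  exact not_coneType_le h0 h
    ((((mem_stableExponents_iff hq hnt).1 hj).coneType_le hj1.2).trans hj1.1)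

end ExponentType

/-- The minimal number of generators of a module, read off from a generating family that maps to
the standard basis under a semilinear map to a finite-dimensional vector space. -/
lemma spanFinrank_top_eq_card {A K Q ι : Type*} [Ring A] [Field K] (σ : A →+* K)
    [RingHomSurjective σ] [AddCommGroup Q] [Module A Q] [Fintype ι] [DecidableEq ι]
    (F : Q →ₛₗ[σ] (ι → K)) (v : ι → Q) (hv : Submodule.span A (Set.range v) = ⊤)
    (hF : ∀ i, F (v i) = Pi.single i 1) :
    (⊤ : Submodule A Q).spanFinrank = Fintype.card ι := by
  have hfg : (⊤ : Submodule A Q).FG := by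
    rw [← hv]
    exact Submodule.fg_span (Set.finite_range v)
  apply le_antisymm
  · rw [← hv]
    refine (Submodule.spanFinrank_span_le_ncard_of_finite (Set.finite_range v)).trans ?_
    rw [← Set.image_univ, ← Nat.card_eq_fintype_card, ← Set.ncard_univ]
    exact Set.ncard_image_le Set.finite_univ
  · have hmap : Submodule.map F ⊤ = ⊤ := by
      rw [← hv, Submodule.map_span, ← Set.range_comp, eq_top_iff, ← (Pi.basisFun K ι).span_eq]
      refine Submodule.span_mono ?_
      rintro _ ⟨i, rfl⟩
      exact ⟨i, (hF i).trans (Pi.basisFun_apply K ι i).symm⟩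
    have h1 := Submodule.spanFinrank_map_le_of_fg F hfg
    rwa [hmap, ← Module.finrank_eq_spanFinrank_of_free, Module.finrank_fintype_fun_eq_card] at h1

/-! ### The Stanley–Reisner complex, bracket powers and colon ideals. -/

section StanleyReisner

open MvPowerSeries InversePolynomial

variable {k : Type u} [Field k] {m : ℕ}

/-- The exponent vector of the squarefree monomial on `s`. -/
noncomputable def faceExponent (s : Finset (Fin m)) : Fin m →₀ ℕ :=
  Finsupp.equivFunOnFinite.symm fun i => if i ∈ s then 1 else 0

lemma faceExponent_apply (s : Finset (Fin m)) (i : Fin m) :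
    faceExponent s i = if i ∈ s then 1 else 0 := rfl

lemma support_faceExponent (s : Finset (Fin m)) : (faceExponent s).support = s := by
  ext i
  simp [faceExponent_apply]

lemma sqfreeMonomial_eq (s : Finset (Fin m)) :
    sqfreeMonomial k s = monomial (faceExponent s) 1 := by
  induction s using Finset.induction_on with
  | empty =>
    rw [sqfreeMonomial, Finset.prod_empty]
    have : faceExponent (∅ : Finset (Fin m)) = 0 := by
      ext i
      simp [faceExponent_apply]
    rw [this, monomial_zero_one]
  | insert i s hi ih =>
    rw [sqfreeMonomial, Finset.prod_insert hi]
    change X i * sqfreeMonomial k s = _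
    rw [ih, X, monomial_mul_monomial, one_mul]
    refine congrArg (fun e => monomial e (1 : k)) (Finsupp.ext fun l => ?_)
    simp only [Finsupp.add_apply, faceExponent_apply, Finset.mem_insert, Finsupp.single_apply]
    by_cases h1 : i = l
    · subst h1
      simp [hi]
    · simp [h1, Ne.symm h1]

/-- The simplicial complex of the squarefree monomials outside `I`. -/
def stanleyReisnerComplex (I : Ideal (MvPowerSeries (Fin m) k)) : LowerSet (Finset (Fin m)) where
  carrier := {s | sqfreeMonomial k s ∉ I}
  lower' s _ h hs := fun h' => (show sqfreeMonomial k s ∉ I from hs)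
    (I.mem_of_dvd (Finset.prod_dvd_prod_of_subset _ _ _ h) h')

lemma mem_stanleyReisnerComplex {I : Ideal (MvPowerSeries (Fin m) k)} {s : Finset (Fin m)} :
    s ∈ stanleyReisnerComplex I ↔ sqfreeMonomial k s ∉ I := Iff.rfl

lemma faceExponent_support_le (j : Fin m →₀ ℕ) : faceExponent j.support ≤ j := fun i => by
  rw [faceExponent_apply]
  split_ifs with h
  · exact Nat.one_le_iff_ne_zero.2 (Finsupp.mem_support_iff.1 h)
  · exact Nat.zero_le _

/-- Every monomial is divisible by the squarefree monomial on its support, so the finitely many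
squarefree monomials of nonfaces generate. -/
lemma IsSquarefreeMonomialIdeal.eq_supportIdeal {I : Ideal (MvPowerSeries (Fin m) k)}
    (hI : IsSquarefreeMonomialIdeal I) :
    I = supportIdeal k (nonfaceExponents (stanleyReisnerComplex I)) := by
  apply le_antisymm
  · obtain ⟨𝒢, h𝒢⟩ := hI
    conv_lhs => rw [h𝒢]
    rw [Ideal.span_le]
    rintro _ ⟨s, hs, rfl⟩
    rw [sqfreeMonomial_eq]
    refine monomial_mem_supportIdeal.2 ?_
    rw [mem_nonfaceExponents, support_faceExponent, mem_stanleyReisnerComplex, not_not, h𝒢]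
    exact Ideal.subset_span ⟨s, hs, rfl⟩
  · rw [supportIdeal_eq_span (T := faceExponent '' {s | s ∉ stanleyReisnerComplex I})
      (Set.toFinite _), Ideal.span_le]
    · rintro _ ⟨_, ⟨s, hs, rfl⟩, rfl⟩
      rw [Set.mem_ofPred_eq, mem_stanleyReisnerComplex, not_not, sqfreeMonomial_eq] at hs
      exact hs
    · rintro _ ⟨s, hs, rfl⟩
      change faceExponent s ∈ nonfaceExponents _
      rwa [mem_nonfaceExponents, support_faceExponent]
    · exact fun j hj => ⟨_, ⟨j.support, hj, rfl⟩, faceExponent_support_le j⟩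

lemma empty_mem_stanleyReisnerComplex (I : Ideal (MvPowerSeries (Fin m) k))
    [Nontrivial (MvPowerSeries (Fin m) k ⧸ I)] : ∅ ∈ stanleyReisnerComplex I := by
  rw [mem_stanleyReisnerComplex, sqfreeMonomial, Finset.prod_empty]
  exact fun h => Ideal.Quotient.nontrivial_iff.1 ‹_› ((Ideal.eq_top_iff_one I).2 h)

/-- A face F that stops being a face on adding i is the same as a monomial of I that leaves I on
removing x_i, via s = F ∪ {i}. Thus U is the set of points that are not cone points. -/
lemma mem_occurringVars {I : Ideal (MvPowerSeries (Fin m) k)} {i : Fin m} :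
    i ∈ occurringVars I ↔ coneType (stanleyReisnerComplex I) i = 1 := by
  simp only [coneType_eq_one_iff, occurringVars, Finset.mem_filter, Finset.mem_univ, true_and,
    mem_stanleyReisnerComplex, not_not]
  constructor
  · rintro ⟨s, his, hs, hs'⟩
    exact ⟨s.erase i, hs', by rwa [Finset.insert_erase his]⟩
  · rintro ⟨F, hF, hF'⟩
    have hi : i ∉ F := fun h => hF (by rwa [Finset.insert_eq_of_mem h] at hF')
    exact ⟨insert i F, Finset.mem_insert_self i F, hF', by rwa [Finset.erase_insert hi]⟩

lemma sqfreeMonomial_occurringVars_pow (I : Ideal (MvPowerSeries (Fin m) k)) (q : ℕ) :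
    sqfreeMonomial k (occurringVars I) ^ (q - 1) =
      monomial (typeExponent q (coneType (stanleyReisnerComplex I))) 1 := by
  rw [sqfreeMonomial_eq, monomial_pow, one_pow]
  refine congrArg (fun e => monomial e (1 : k)) (Finsupp.ext fun i => ?_)
  rw [Finsupp.smul_apply, faceExponent_apply, typeExponent_apply]
  simp only [mem_occurringVars]
  unfold coneType
  split_ifs <;> simp_all [typeValue]

variable {I : Ideal (MvPowerSeries (Fin m) k)} {Δ : LowerSet (Finset (Fin m))}
  (hI : I = supportIdeal k (nonfaceExponents Δ)) (p : ℕ) [Fact p.Prime] [CharP k p]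

include hI

/-- The exponents of f^p are p times exponents of f, and conversely an exponent that is at least p
on a nonface s is divisible by the p-th power of the squarefree monomial on s. -/
lemma bracketPower_eq_supportIdeal :
    bracketPower I p = supportIdeal k (trivialExponents Δ p) := by
  have hp : 2 ≤ p := (Fact.out : p.Prime).two_le
  apply le_antisymm
  · rw [bracketPower, Ideal.span_le]
    rintro _ ⟨f, hf, rfl⟩
    intro j hj
    obtain ⟨u, rfl, hu⟩ := exists_eq_smul_of_coeff_pow_ne_zero p 1 f j (by simpa using hj)
    rw [hI] at hf
    rw [mem_trivialExponents_iff hp]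
    intro h
    refine hf u hu (Δ.lower ?_ h)
    intro i hi
    rw [mem_typeFiber, exponentType, typeOf_eq_two_iff, pow_one, Finsupp.smul_apply, smul_eq_mul]
    exact Nat.le_mul_of_pos_right p (Nat.pos_of_ne_zero (Finsupp.mem_support_iff.1 hi))
  · rw [supportIdeal_eq_span (T := (fun s => p • faceExponent s) '' {s | s ∉ Δ})
      (Set.toFinite _), Ideal.span_le]
    · rintro _ ⟨_, ⟨s, hs, rfl⟩, rfl⟩
      refine Ideal.subset_span ⟨monomial (faceExponent s) 1, ?_, ?_⟩
      · rw [hI]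
        refine monomial_mem_supportIdeal.2 ?_
        rwa [mem_nonfaceExponents, support_faceExponent]
      · change monomial _ _ ^ p = _
        rw [monomial_pow, one_pow]
    · rintro _ ⟨s, hs, rfl⟩
      change p • faceExponent s ∈ trivialExponents Δ p
      rw [mem_trivialExponents_iff hp]
      refine fun h => hs (Δ.lower ?_ h)
      intro i hi
      rw [mem_typeFiber, exponentType, typeOf_eq_two_iff, Finsupp.smul_apply, faceExponent_apply,
        if_pos hi, smul_eq_mul, mul_one]
    · intro j hj
      refine ⟨_, ⟨_, (mem_trivialExponents_iff hp).1 hj, rfl⟩, fun i => ?_⟩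
      rw [Finsupp.smul_apply, faceExponent_apply]
      split_ifs with h
      · rw [mem_typeFiber, exponentType, typeOf_eq_two_iff] at h
        simpa using h
      · simp

/-- Stability says that c + a is a trivial exponent for every nonface exponent a, which is the colon
condition read on monomials. -/
lemma monomial_mem_colon_iff (c : Fin m →₀ ℕ) :
    monomial c (1 : k) ∈ (bracketPower I p).colon (I : Set (MvPowerSeries (Fin m) k)) ↔
      c ∈ stableExponents Δ p := by
  rw [Submodule.mem_colon, bracketPower_eq_supportIdeal hI p]
  constructor
  · intro h b a hb ha hab
    have h1 : monomial a (1 : k) ∈ I := by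
      rw [hI]
      exact monomial_mem_supportIdeal.2 ha
    have h2 := h _ h1
    rw [smul_eq_mul, monomial_mul_monomial, one_mul, monomial_mem_supportIdeal] at h2
    exact h2 b 0 hb (by rw [add_zero, hab])
  · intro h f hf j hj b a hb hab
    rw [smul_eq_mul, coeff_monomial_mul] at hj
    split_ifs at hj with hc
    · have hf' : f ∈ I := hf
      rw [hI] at hf'
      have h1 := hf' _ (right_ne_zero_of_mul hj)
      refine h b (j - c + a) hb (fun h2 => h1 (Δ.lower (Finsupp.support_mono le_self_add) h2)) ?_
      rw [← add_assoc, add_tsub_cancel_of_le hc, hab]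
    · exact hj rfl

end StanleyReisner

/-! ### The ideal J_p and its minimal generators. -/

section IdealJ

open MvPowerSeries InversePolynomial

variable {k : Type u} [Field k] {m : ℕ} {I : Ideal (MvPowerSeries (Fin m) k)}
  (hI : IsSquarefreeMonomialIdeal I) (p : ℕ) [Fact p.Prime] [CharP k p]

include hI

lemma monomial_mem_sup_iff (c : Fin m →₀ ℕ) :
    monomial c (1 : k) ∈
        bracketPower I p ⊔ Ideal.span {sqfreeMonomial k (occurringVars I) ^ (p - 1)} ↔
      c ∈ trivialExponents (stanleyReisnerComplex I) p ∨
        typeExponent p (coneType (stanleyReisnerComplex I)) ≤ c := by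
  classical
  rw [bracketPower_eq_supportIdeal hI.eq_supportIdeal p, sqfreeMonomial_occurringVars_pow,
    Submodule.mem_sup]
  constructor
  · rintro ⟨f, hf, g, hg, hfg⟩
    obtain ⟨r, rfl⟩ := Ideal.mem_span_singleton'.1 hg
    rw [or_iff_not_imp_right]
    intro hc
    refine hf c ?_
    have h1 := congrArg (coeff c) hfg
    rw [map_add, coeff_mul_monomial, if_neg hc, add_zero, coeff_monomial_same] at h1
    rw [h1]
    exact one_ne_zero
  · rintro (h | h)
    · exact ⟨_, monomial_mem_supportIdeal.2 h, 0, zero_mem _, add_zero _⟩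
    · refine ⟨0, zero_mem _, _, Ideal.mem_span_singleton'.2
        ⟨monomial (c - typeExponent p (coneType (stanleyReisnerComplex I))) 1, rfl⟩, ?_⟩
      rw [monomial_mul_monomial, tsub_add_cancel_of_le h, one_mul, zero_add]

variable [Nontrivial (MvPowerSeries (Fin m) k ⧸ I)]

/-- The defining monomials have good types not above the cone type, so each is divisible by one of
proper type; the latter satisfy the defining conditions themselves. -/
lemma idealJ_eq_span :
    idealJ I p = Ideal.span ((fun τ => monomial (typeExponent p τ) (1 : k)) ''
      (properTypes (stanleyReisnerComplex I) : Set (Fin m → Fin 3))) := by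
  have hp : 2 ≤ p := (Fact.out : p.Prime).two_le
  have h0 := empty_mem_stanleyReisnerComplex I
  apply le_antisymm
  · rw [idealJ, Ideal.span_le]
    rintro _ ⟨c, rfl, hc, h1, h2⟩
    rw [monomial_mem_colon_iff hI.eq_supportIdeal] at h1
    rw [monomial_mem_sup_iff hI, not_or] at h2
    rw [mem_stableExponents_iff hp h2.1] at h1
    rw [typeExponent_le_iff hp] at h2
    obtain ⟨σ, hσ, hle⟩ := exists_properTypes_le h1 h2.2
    rw [← typeExponent_le_iff hp] at hle
    have h3 : monomial c (1 : k) = monomial (c - typeExponent p σ) 1 *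
        monomial (typeExponent p σ) 1 := by
      rw [monomial_mul_monomial, one_mul, tsub_add_cancel_of_le hle]
    rw [h3]
    exact Ideal.mul_mem_left _ _ (Ideal.subset_span ⟨σ, hσ, rfl⟩)
  · rw [Ideal.span_le]
    rintro _ ⟨τ, hτ, rfl⟩
    have hgood := (mem_properTypes.1 hτ).2.1
    refine Ideal.subset_span ⟨typeExponent p τ, rfl, fun i => ?_, ?_, ?_⟩
    · rw [typeExponent_apply]
      generalize τ i = x
      fin_cases x <;> simp [typeValue]
    · rw [monomial_mem_colon_iff hI.eq_supportIdeal]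
      exact typeExponent_mem_stableExponents hp hgood
    · rw [monomial_mem_sup_iff hI, not_or, typeExponent_le_iff hp, exponentType_typeExponent hp]
      exact ⟨typeExponent_notMem_trivialExponents hp hgood, not_coneType_le h0 hτ⟩

lemma spanFinrank_idealJ :
    (idealJ I p).spanFinrank = (properTypes (stanleyReisnerComplex I)).card := by
  classical
  have hp : 2 ≤ p := (Fact.out : p.Prime).two_le
  have hJ := idealJ_eq_span hI p
  have hle : idealJ I p ≤ supportIdeal k (stableExponents (stanleyReisnerComplex I) p) := by
    rw [hJ, Ideal.span_le]
    rintro _ ⟨τ, hτ, rfl⟩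
    exact monomial_mem_supportIdeal.2
      (typeExponent_mem_stableExponents hp (mem_properTypes.1 hτ).2.1)
  have : RingHomSurjective (constantCoeff (σ := Fin m) (R := k)) :=
    ⟨fun c => ⟨C c, constantCoeff_C c⟩⟩
  -- Proper exponents are minimal among the stable ones, so multiplication by r scales these
  -- coefficients by the constant term of r.
  let F : idealJ I p →ₛₗ[constantCoeff (σ := Fin m) (R := k)]
      (properTypes (stanleyReisnerComplex I) → k) :=
    { toFun := fun f τ => coeff (typeExponent p τ.1) (f : MvPowerSeries (Fin m) k)
      map_add' := fun f g => rfl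
      map_smul' := fun r f => funext fun τ => coeff_mul_of_minimal (hle f.2) r fun j hj hj' =>
        eq_typeExponent_of_le hp (mem_properTypes.1 τ.2).2 hj hj' }
  let v : properTypes (stanleyReisnerComplex I) → idealJ I p := fun τ =>
    ⟨monomial (typeExponent p τ.1) 1, by rw [hJ]; exact Ideal.subset_span ⟨τ.1, τ.2, rfl⟩⟩
  rw [← Submodule.spanFinrank_top, spanFinrank_top_eq_card constantCoeff F v, Fintype.card_coe]
  · rw [← (Submodule.map_injective_of_injective (idealJ I p).injective_subtype).eq_iff,
      Submodule.map_span, ← Set.range_comp, Submodule.map_top, Submodule.range_subtype]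
    conv_rhs => rw [hJ]
    congr 1
    ext f
    simp [v]
  · intro τ
    ext σ
    change coeff (typeExponent p σ.1) (monomial (typeExponent p τ.1) (1 : k)) = _
    rw [coeff_monomial, Pi.single_apply]
    have : typeExponent p σ.1 = typeExponent p τ.1 ↔ σ = τ := by
      refine ⟨fun h => Subtype.ext ?_, fun h => by rw [h]⟩
      rw [← exponentType_typeExponent hp σ.1, h, exponentType_typeExponent hp]
    simp only [this]

end IdealJ

/-! ### Computing complexity sequences of graded rings. -/

namespace GradedComplexity

section Decomposable

variable {A : ℕ → Type*} [∀ e, AddCommGroup (A e)] [DirectSum.GRing A]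

/-- A bound for the decomposable elements of degree `n + 1`. -/
lemma mem_of_mem_decomposableSucc {n : ℕ} (N : AddSubgroup (A (n + 1)))
    (hl : ∀ a : A 0, ∀ x ∈ N, ∀ y : A (n + 1),
      DirectSum.of A _ y = DirectSum.of A _ a * DirectSum.of A _ x → y ∈ N)
    (hr : ∀ x ∈ N, ∀ a : A 0, ∀ y : A (n + 1),
      DirectSum.of A _ y = DirectSum.of A _ x * DirectSum.of A _ a → y ∈ N)
    (hmul : ∀ i j, 0 < i → 0 < j → i + j = n + 1 → ∀ (x : A i) (y : A j) (z : A (n + 1)),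
      DirectSum.of A _ z = DirectSum.of A _ x * DirectSum.of A _ y → z ∈ N)
    {x : A (n + 1)} (hx : x ∈ decomposableSucc A n) : x ∈ N := by
  classical
  have hcast : ∀ {s : ℕ} (_ : s = n + 1) (z : A s),
      DirectSum.of A (n + 1) ((DirectSum.of A s z) (n + 1)) = DirectSum.of A s z := by
    rintro _ rfl z
    rw [DirectSum.of_eq_same]
  -- The elements whose component of degree n + 1 lies in N form a subring by the three hypotheses;
  -- generators of degree at most n belong to it because that component is zero.
  let H : Subring (⨁ e, A e) :=
    { carrier := {x | x (n + 1) ∈ N}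
      zero_mem' := N.zero_mem
      one_mem' := by
        change (DirectSum.of A 0 1) (n + 1) ∈ N
        rw [DirectSum.of_eq_of_ne _ _ _ (Nat.succ_ne_zero n)]
        exact N.zero_mem
      add_mem' := fun {x y} hx hy => N.add_mem hx hy
      neg_mem' := fun {x} hx => N.neg_mem hx
      mul_mem' := by
        intro x y hx hy
        change (x * y) (n + 1) ∈ N
        rw [DirectSum.mul_eq_sum_support_ghas_mul, DFinsupp.finsetSum_apply]
        refine sum_mem fun ij _ => ?_
        obtain ⟨i, j⟩ := ij
        by_cases hsum : i + j = n + 1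
        · have h1 := hcast hsum (GradedMonoid.GMul.mul (x i) (y j))
          rw [← DirectSum.of_mul_of] at h1
          change ((DirectSum.of A (i + j)) (GradedMonoid.GMul.mul (x i) (y j))) (n + 1) ∈ N
          rw [← DirectSum.of_mul_of]
          rcases Nat.eq_zero_or_pos i with rfl | hi
          · obtain rfl : j = n + 1 := by omega
            exact hl (x 0) _ hy _ h1
          · rcases Nat.eq_zero_or_pos j with rfl | hj
            · obtain rfl : i = n + 1 := by omega
              exact hr _ hx (y 0) _ h1
            · exact hmul i j hi hj hsum _ _ _ h1
        · rw [DirectSum.of_eq_of_ne _ _ _ (Ne.symm hsum)]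
          exact N.zero_mem }
  have hGH : G A n ≤ H := by
    refine Subring.closure_le.2 ?_
    rintro _ ⟨i, hi, a, rfl⟩
    change (DirectSum.of A i a) (n + 1) ∈ N
    rw [DirectSum.of_eq_of_ne _ _ _ (by omega)]
    exact N.zero_mem
  have h1 : (DirectSum.of A (n + 1) x) (n + 1) ∈ N := hGH hx
  rwa [DirectSum.of_eq_same] at h1

lemma mem_decomposableSucc_of_eq_mul {n i j : ℕ} (hi : i ≤ n) (hj : j ≤ n)
    {x : A i} {y : A j} {z : A (n + 1)}
    (hz : DirectSum.of A _ z = DirectSum.of A _ x * DirectSum.of A _ y) :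
    z ∈ decomposableSucc A n := by
  change DirectSum.of A (n + 1) z ∈ G A n
  rw [hz]
  exact mul_mem (Subring.subset_closure ⟨i, hi, x, rfl⟩) (Subring.subset_closure ⟨j, hj, y, rfl⟩)

end Decomposable

section Criteria

variable {A : ℕ → Type*} [∀ e, AddCommGroup (A e)] [DirectSum.GRing A]

/-- The members of the complexity sequence, read off from a family that generates modulo
decomposable elements and maps to a standard basis. -/
lemma complexitySeq_eq_card {K ι : Type*} [Field K] [Fintype ι] [DecidableEq ι] {e : ℕ}
    (σ : A 0 →+* K) [RingHomSurjective σ] (F : A e →ₛₗ[σ] (ι → K)) (v : ι → A e)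
    (hv : Submodule.span (A 0) (Set.range v) ⊔ decomposable A e = ⊤)
    (hF : ∀ i, F (v i) = Pi.single i 1) (hker : decomposable A e ≤ LinearMap.ker F) :
    complexitySeq A e = Fintype.card ι := by
  refine spanFinrank_top_eq_card σ ((decomposable A e).liftQ F hker)
    (fun i => (decomposable A e).mkQ (v i)) ?_ hF
  have h1 := congrArg (Submodule.map (decomposable A e).mkQ) hv
  rw [Submodule.map_sup, Submodule.map_span, ← Set.range_comp, Submodule.map_top,
    Submodule.range_mkQ, Submodule.mkQ_map_self, sup_bot_eq] at h1
  exact h1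

/-- A degreewise finite graded ring whose complexity sequence vanishes from degree two on is
finitely generated. -/
lemma isFinitelyGenerated_of_complexitySeq_eq_zero (hfin : IsDegreewiseFinite A)
    (h : ∀ e, 2 ≤ e → complexitySeq A e = 0) : IsFinitelyGenerated A := by
  obtain ⟨s, hs⟩ := (hfin 1).fg_top
  refine ⟨DirectSum.of A 1 '' s, s.finite_toSet.image _, ?_⟩
  set H := Subring.closure (Set.range (DirectSum.of A 0) ∪ DirectSum.of A 1 '' s)
  have h0 : ∀ a, DirectSum.of A 0 a ∈ H := fun a => Subring.subset_closure (Or.inl ⟨a, rfl⟩)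
  have key : ∀ e, ∀ i ≤ e, ∀ x, DirectSum.of A i x ∈ H := by
    intro e
    induction e with
    | zero =>
      intro i hi x
      obtain rfl : i = 0 := by omega
      exact h0 x
    | succ e ih =>
      intro i hi x
      rcases Nat.lt_or_ge i (e + 1) with hlt | hge
      · exact ih i (by omega) x
      obtain rfl : i = e + 1 := by omega
      rcases Nat.eq_zero_or_pos e with rfl | he
      · have hx : x ∈ Submodule.span (A 0) (s : Set (A 1)) := hs ▸ Submodule.mem_top
        induction hx using Submodule.span_induction with
        | mem y hy => exact Subring.subset_closure (Or.inr ⟨y, hy, rfl⟩)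
        | zero =>
          rw [map_zero]
          exact H.zero_mem
        | add y z _ _ hy hz =>
          rw [map_add]
          exact H.add_mem hy hz
        | smul a y _ hy =>
          rw [DirectSum.of_zero_smul]
          exact H.mul_mem (h0 a) hy
      · have := hfin (e + 1)
        have h1 : (⊤ : Submodule (A 0) (A (e + 1) ⧸ decomposable A (e + 1))) = ⊥ :=
          (Submodule.spanFinrank_eq_zero_iff_eq_bot Module.Finite.fg_top).1 (h (e + 1) (by omega))
        have h2 : (decomposable A (e + 1)).mkQ x = 0 := by
          rw [← Submodule.mem_bot (A 0), ← h1]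
          exact Submodule.mem_top
        rw [Submodule.mkQ_apply, Submodule.Quotient.mk_eq_zero] at h2
        have h3 : G A e ≤ H := by
          refine Subring.closure_le.2 ?_
          rintro _ ⟨i, hi, a, rfl⟩
          exact ih i hi a
        exact h3 h2
  rw [eq_top_iff]
  intro x _
  induction x using DirectSum.induction_on with
  | zero => exact H.zero_mem
  | of i x => exact key i i le_rfl x
  | add x y hx hy => exact H.add_mem (hx trivial) (hy trivial)

/-- A nonzero eventually constant sequence is bounded, but it is not O(r^e) for r < 1, as r^e tends
to 0. -/
lemma complexity_eq_one {n : ℕ} (hn : n ≠ 0) (h : ∀ e, 2 ≤ e → complexitySeq A e = n) :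
    complexity A = 1 := by
  apply le_antisymm
  · refine sInf_le ⟨1, by simp, ?_⟩
    refine Asymptotics.IsBigO.of_bound n (Filter.eventually_atTop.2 ⟨2, fun e he => ?_⟩)
    rw [h e he]
    simp
  · refine le_sInf ?_
    rintro _ ⟨r, rfl, hr⟩
    by_contra hlt
    have hlt' : r < 1 := by simpa using hlt
    have h1 : Filter.Tendsto (fun e : ℕ => (r : ℝ) ^ e) Filter.atTop (nhds 0) :=
      tendsto_pow_atTop_nhds_zero_of_lt_one r.2 (by exact_mod_cast hlt')
    have h2 := hr.trans_tendsto h1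
    have h3 : Filter.Tendsto (fun e : ℕ => (complexitySeq A e : ℝ)) Filter.atTop (nhds (n : ℝ)) :=
      tendsto_const_nhds.congr' (Filter.eventually_atTop.2 ⟨2, fun e he => congrArg Nat.cast (h e he).symm⟩)
    have h4 := tendsto_nhds_unique h3 h2
    exact hn (by exact_mod_cast h4)

/-- Multiplication by 1 - T takes successive differences of the sequence: 1, n, -1, 0, 0, …. -/
lemma generatingFunction_eq {n : ℕ} (h0 : complexitySeq A 0 = 1) (h1 : complexitySeq A 1 = n + 1)
    (h : ∀ e, 2 ≤ e → complexitySeq A e = n) :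
    generatingFunction A = (1 + (n : PowerSeries ℚ) * PowerSeries.X - PowerSeries.X ^ 2) *
      (1 - PowerSeries.X)⁻¹ := by
  rw [PowerSeries.eq_mul_inv_iff_mul_eq (by simp)]
  ext e
  have hn : (n : PowerSeries ℚ) = PowerSeries.C (n : ℚ) := (map_natCast PowerSeries.C n).symm
  rw [mul_sub, mul_one, hn]
  match e with
  | 0 => simp [-map_natCast, generatingFunction, h0]
  | 1 =>
    simp [-map_natCast, generatingFunction, h0, h1, PowerSeries.coeff_one, PowerSeries.coeff_X_pow,
      PowerSeries.coeff_succ_mul_X]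
  | 2 =>
    simp [-map_natCast, generatingFunction, h1, h 2 le_rfl, PowerSeries.coeff_one, PowerSeries.coeff_X_pow,
      PowerSeries.coeff_succ_mul_X]
  | e + 3 =>
    simp [-map_natCast, generatingFunction, h (e + 3) (by omega), h (e + 2) (by omega), PowerSeries.coeff_one,
      PowerSeries.coeff_X_pow, PowerSeries.coeff_succ_mul_X]

end Criteria

end GradedComplexity

/-! ### The complexity sequence of a graded ring described by power series. -/

open MvPowerSeries GradedComplexity

/-- A description of a graded ring by power series in which the degree `e` piece consists of the
series with stable exponents modulo those with trivial exponents, and the product of `f` in degree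
`e` and `g` is `f * g ^ p ^ e`. -/
structure PowerSeriesModel (k : Type*) [Field k] (p : ℕ) {m : ℕ} (Δ : LowerSet (Finset (Fin m)))
    (A : ℕ → Type*) [∀ e, AddCommGroup (A e)] [DirectSum.GRing A] where
  /-- The series `f` represents the element `x` of degree `e`. -/
  Rel : ∀ e : ℕ, MvPowerSeries (Fin m) k → A e → Prop
  add : ∀ {e f g x y}, Rel e f x → Rel e g y → Rel e (f + g) (x + y)
  mul : ∀ {e e' n f g x y z}, e + e' = n → Rel e f x → Rel e' g y →
    DirectSum.of A n z = DirectSum.of A e x * DirectSum.of A e' y → Rel n (f * g ^ p ^ e) z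
  one : Rel 0 1 1
  ext : ∀ {e f x y}, Rel e f x → Rel e f y → x = y
  sub_mem : ∀ {e f g x}, Rel e f x → Rel e g x → f - g ∈ supportIdeal k (trivialExponents Δ (p ^ e))
  of_sub_mem : ∀ {e f g x}, Rel e f x → f - g ∈ supportIdeal k (trivialExponents Δ (p ^ e)) →
    Rel e g x
  mem_stable : ∀ {e f x}, Rel e f x → f ∈ supportIdeal k (stableExponents Δ (p ^ e))
  exists_rel : ∀ {e} (x : A e), ∃ f, Rel e f x
  exists_of_mem_stable : ∀ {e f}, f ∈ supportIdeal k (stableExponents Δ (p ^ e)) → ∃ x, Rel e f x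

namespace PowerSeriesModel

variable {k : Type*} [Field k] {p : ℕ} {m : ℕ} {Δ : LowerSet (Finset (Fin m))}
  {A : ℕ → Type*} [∀ e, AddCommGroup (A e)] [DirectSum.GRing A]
  (M : PowerSeriesModel k p Δ A)

/-- A chosen series that represents `x`. -/
noncomputable def repr {e : ℕ} (x : A e) : MvPowerSeries (Fin m) k := (M.exists_rel x).choose

lemma rel_repr {e : ℕ} (x : A e) : M.Rel e (M.repr x) x := (M.exists_rel x).choose_spec

lemma coeff_repr {e : ℕ} {f : MvPowerSeries (Fin m) k} {x : A e} (h : M.Rel e f x)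
    {j : Fin m →₀ ℕ} (hj : j ∉ trivialExponents Δ (p ^ e)) : coeff j (M.repr x) = coeff j f := by
  by_contra hne
  refine hj (M.sub_mem (M.rel_repr x) h j ?_)
  rwa [map_sub, sub_ne_zero]

lemma rel_smul {e : ℕ} {f g : MvPowerSeries (Fin m) k} {a : A 0} {x : A e} (ha : M.Rel 0 g a)
    (hx : M.Rel e f x) : M.Rel e (g * f) (a • x) := by
  have h := M.mul (zero_add e) ha hx (DirectSum.of_zero_smul A a x)
  rwa [pow_zero, pow_one] at h

/-- For q = 1 the Frobenius exponent of b is b itself, so a divides it and has smaller support: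
every series acts in degree zero. -/
lemma mem_stable_zero (f : MvPowerSeries (Fin m) k) :
    f ∈ supportIdeal k (stableExponents Δ (p ^ 0)) := by
  intro j _ b a hb ha hab
  refine ha (Δ.lower (Finsupp.support_mono fun i => ?_) hb)
  have := DFunLike.congr_fun hab i
  simp only [Finsupp.add_apply, InversePolynomial.frobExponent_apply, pow_zero, one_mul] at this
  omega

variable (h0 : ∅ ∈ Δ)

include h0 in
lemma constantCoeff_repr {f : MvPowerSeries (Fin m) k} {a : A 0} (h : M.Rel 0 f a) :
    constantCoeff (M.repr a) = constantCoeff f := by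
  rw [← coeff_zero_eq_constantCoeff]
  exact M.coeff_repr h (zero_notMem_trivialExponents h0 _)

/-- The residue map of the degree zero piece. -/
noncomputable def residue : A 0 →+* k :=
  RingHom.mk'
    { toFun := fun a => constantCoeff (M.repr a)
      map_one' := by rw [M.constantCoeff_repr h0 M.one, map_one]
      map_mul' := fun a b => by
        have h := M.mul (zero_add 0) (M.rel_repr a) (M.rel_repr b) (DirectSum.of_zero_mul A a b)
        rw [M.constantCoeff_repr h0 h, pow_zero, pow_one, map_mul] }
    fun a b => by
      change constantCoeff (M.repr (a + b)) = constantCoeff (M.repr a) + constantCoeff (M.repr b)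
      rw [M.constantCoeff_repr h0 (M.add (M.rel_repr a) (M.rel_repr b)), map_add]

lemma residue_apply {f : MvPowerSeries (Fin m) k} {a : A 0} (h : M.Rel 0 f a) :
    M.residue h0 a = constantCoeff f := M.constantCoeff_repr h0 h

lemma residue_surjective : Function.Surjective (M.residue h0) := fun r => by
  obtain ⟨a, ha⟩ := M.exists_of_mem_stable (mem_stable_zero (C r))
  exact ⟨a, by rw [M.residue_apply h0 ha, constantCoeff_C]⟩

include M h0 in
lemma complexitySeq_zero : complexitySeq A 0 = 1 := by
  have : RingHomSurjective (M.residue h0) := ⟨M.residue_surjective h0⟩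
  let F : A 0 →ₛₗ[M.residue h0] (Unit → k) :=
    { toFun := fun a _ => M.residue h0 a
      map_add' := fun a b => funext fun _ => map_add _ a b
      map_smul' := fun a b => funext fun _ => by
        rw [M.residue_apply h0 (M.rel_smul (M.rel_repr a) (M.rel_repr b)), map_mul]
        rfl }
  refine (complexitySeq_eq_card (M.residue h0) F (fun _ => 1) ?_ ?_ bot_le).trans
    Fintype.card_unit
  · rw [eq_top_iff]
    intro x _
    have hx : x = x • (1 : A 0) := by
      apply DirectSum.of_injective 0
      rw [DirectSum.of_zero_smul, DirectSum.of_zero_one, mul_one]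
    rw [hx]
    exact Submodule.mem_sup_left (Submodule.smul_mem _ _ (Submodule.subset_span ⟨(), rfl⟩))
  · intro i
    ext j
    obtain rfl : j = i := rfl
    rw [Pi.single_eq_same]
    exact map_one (M.residue h0)

variable [Fact p.Prime] {e : ℕ} (he : e ≠ 0)

omit [DirectSum.GRing A] [∀ e, AddCommGroup (A e)] in
lemma two_le_pow (he : e ≠ 0) : 2 ≤ p ^ e :=
  (Fact.out : p.Prime).two_le.trans (Nat.le_self_pow he p)

/-- The coefficients at the exponents of a set of minimal good types. -/
noncomputable def coeffMap (T : Finset (Fin m → Fin 3)) (hT : T ⊆ minGoodTypes Δ) :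
    A e →ₛₗ[M.residue h0] (T → k) where
  toFun x τ := coeff (typeExponent (p ^ e) τ.1) (M.repr x)
  map_add' x y := funext fun τ => by
    rw [M.coeff_repr (M.add (M.rel_repr x) (M.rel_repr y))
      (typeExponent_notMem_trivialExponents (two_le_pow he) (mem_minGoodTypes.1 (hT τ.2)).1),
      map_add]
    rfl
  map_smul' a x := funext fun τ => by
    have hτ := mem_minGoodTypes.1 (hT τ.2)
    rw [M.coeff_repr (M.rel_smul (M.rel_repr a) (M.rel_repr x))
      (typeExponent_notMem_trivialExponents (two_le_pow he) hτ.1),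
      coeff_mul_of_minimal (M.mem_stable (M.rel_repr x)) _ fun j hj hj' =>
        eq_typeExponent_of_le (two_le_pow he) hτ hj hj']
    rfl

lemma coeffMap_apply {T : Finset (Fin m → Fin 3)} (hT : T ⊆ minGoodTypes Δ)
    {f : MvPowerSeries (Fin m) k} {x : A e} (h : M.Rel e f x) (τ : T) :
    M.coeffMap h0 he T hT x τ = coeff (typeExponent (p ^ e) τ.1) f :=
  M.coeff_repr h
    (typeExponent_notMem_trivialExponents (two_le_pow he) (mem_minGoodTypes.1 (hT τ.2)).1)

lemma coeffMap_of_monomial {T : Finset (Fin m → Fin 3)} (hT : T ⊆ minGoodTypes Δ) (τ : T) {x : A e}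
    (h : M.Rel e (monomial (typeExponent (p ^ e) τ.1) 1) x) :
    M.coeffMap h0 he T hT x = Pi.single τ 1 := by
  classical
  ext σ
  rw [M.coeffMap_apply h0 he hT h, coeff_monomial, Pi.single_apply]
  have : typeExponent (p ^ e) σ.1 = typeExponent (p ^ e) τ.1 ↔ σ = τ := by
    refine ⟨fun h => Subtype.ext ?_, fun h => by rw [h]⟩
    rw [← exponentType_typeExponent (two_le_pow (p := p) he) σ.1, h,
      exponentType_typeExponent (two_le_pow he)]
  simp only [this]

include he in
lemma exists_generators : ∃ v : minGoodTypes Δ → A e,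
    ∀ τ, M.Rel e (monomial (typeExponent (p ^ e) τ.1) 1) (v τ) := by
  have h : ∀ τ : minGoodTypes Δ, ∃ x, M.Rel e (monomial (typeExponent (p ^ e) τ.1) 1) x :=
    fun τ => M.exists_of_mem_stable (monomial_mem_supportIdeal.2
      (typeExponent_mem_stableExponents (two_le_pow he) (mem_minGoodTypes.1 τ.2).1))
  choose v hv using h
  exact ⟨v, hv⟩

include he in
lemma span_generators {v : minGoodTypes Δ → A e}
    (hv : ∀ τ, M.Rel e (monomial (typeExponent (p ^ e) τ.1) 1) (v τ)) :
    Submodule.span (A 0) (Set.range v) = ⊤ := by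
  classical
  have hq := two_le_pow (p := p) he
  have key : ∀ f ∈ Ideal.span (Set.range fun τ : minGoodTypes Δ =>
      monomial (typeExponent (p ^ e) τ.1) (1 : k)),
      ∃ x ∈ Submodule.span (A 0) (Set.range v), M.Rel e f x := by
    intro f hf
    induction hf using Submodule.span_induction with
    | mem f hf =>
      obtain ⟨τ, rfl⟩ := hf
      exact ⟨v τ, Submodule.subset_span ⟨τ, rfl⟩, hv τ⟩
    | zero =>
      -- An element x represented by the zero series satisfies x + x = x, so it is zero.
      obtain ⟨x, hx⟩ := M.exists_of_mem_stable (e := e) (f := 0) (zero_mem _)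
      have h1 := M.add hx hx
      rw [add_zero] at h1
      have h2 : x + x = x + 0 := by rw [add_zero, M.ext h1 hx]
      rw [add_left_cancel h2] at hx
      exact ⟨0, zero_mem _, hx⟩
    | add f g _ _ hf hg =>
      obtain ⟨x, hx, hfx⟩ := hf
      obtain ⟨y, hy, hgy⟩ := hg
      exact ⟨x + y, add_mem hx hy, M.add hfx hgy⟩
    | smul r f _ hf =>
      obtain ⟨x, hx, hfx⟩ := hf
      obtain ⟨a, ha⟩ := M.exists_of_mem_stable (mem_stable_zero r)
      exact ⟨a • x, Submodule.smul_mem _ a hx, M.rel_smul ha hfx⟩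
  rw [eq_top_iff]
  intro x _
  obtain ⟨f, hf⟩ := M.exists_rel x
  -- The terms of f that are not divisible by a generator have trivial exponents. Truncating f to W
  -- therefore represents the same element and lies in the monomial ideal of the generators.
  let W : UpperSet (Fin m →₀ ℕ) :=
    ⟨{j | ∃ τ ∈ minGoodTypes Δ, typeExponent (p ^ e) τ ≤ j},
      fun i j hij ⟨τ, hτ, h⟩ => ⟨τ, hτ, h.trans hij⟩⟩
  obtain ⟨g, hg⟩ : ∃ g : MvPowerSeries (Fin m) k, ∀ j, coeff j g = if j ∈ W then coeff j f else 0 :=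
    ⟨fun j => if j ∈ W then coeff j f else 0, fun _ => rfl⟩
  have hgW : g ∈ supportIdeal k W := fun j hj => by
    rw [hg] at hj
    by_contra h
    exact hj (if_neg h)
  rw [supportIdeal_eq_span (T := Set.range fun τ : minGoodTypes Δ => typeExponent (p ^ e) τ.1)
    (Set.finite_range _) (by rintro _ ⟨τ, rfl⟩; exact ⟨τ.1, τ.2, le_rfl⟩)
    (by rintro j ⟨τ, hτ, h⟩; exact ⟨_, ⟨⟨τ, hτ⟩, rfl⟩, h⟩), ← Set.range_comp] at hgW
  have hfg : f - g ∈ supportIdeal k (trivialExponents Δ (p ^ e)) := by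
    intro j hj
    rw [map_sub, hg] at hj
    by_contra hjt
    by_cases hjW : j ∈ W
    · rw [if_pos hjW, sub_self] at hj
      exact hj rfl
    · rw [if_neg hjW, sub_zero] at hj
      have h1 := (mem_stableExponents_iff hq hjt).1 (M.mem_stable hf j hj)
      obtain ⟨σ, hσ, hle⟩ := exists_minGoodTypes_le h1
      exact hjW ⟨σ, hσ, (typeExponent_le_iff hq).2 hle⟩
  obtain ⟨y, hy, hgy⟩ := key g hgW
  rwa [M.ext (M.of_sub_mem hf hfg) hgy]

include M in
lemma isDegreewiseFinite : IsDegreewiseFinite A := by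
  intro e
  rcases eq_or_ne e 0 with rfl | he
  · refine ⟨⟨{1}, ?_⟩⟩
    rw [eq_top_iff]
    intro x _
    have hx : x = x • (1 : A 0) := by
      apply DirectSum.of_injective 0
      rw [DirectSum.of_zero_smul, DirectSum.of_zero_one, mul_one]
    rw [hx]
    exact Submodule.smul_mem _ _ (Submodule.subset_span (by simp))
  · obtain ⟨v, hv⟩ := M.exists_generators he
    refine ⟨?_⟩
    rw [← M.span_generators he hv]
    exact Submodule.fg_span (Set.finite_range v)

include M h0 in
-- Elements of degree zero generate nothing in degree one, so here the cone generator counts as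
-- well.
lemma complexitySeq_one : complexitySeq A 1 = (minGoodTypes Δ).card := by
  classical
  have : RingHomSurjective (M.residue h0) := ⟨M.residue_surjective h0⟩
  obtain ⟨v, hv⟩ := M.exists_generators one_ne_zero
  refine (complexitySeq_eq_card (M.residue h0) (M.coeffMap h0 one_ne_zero _ subset_rfl) v ?_
    (fun τ => M.coeffMap_of_monomial h0 one_ne_zero subset_rfl τ (hv τ)) ?_).trans
    (Fintype.card_coe _)
  · rw [M.span_generators one_ne_zero hv, top_sup_eq]
  · intro x hx
    have h1 : x ∈ (⊥ : AddSubgroup (A 1)) := by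
      refine mem_of_mem_decomposableSucc (n := 0) ⊥ ?_ ?_ ?_ hx
      · intro a x hx y hy
        rw [AddSubgroup.mem_bot] at hx
        rw [hx, map_zero, mul_zero] at hy
        exact DirectSum.of_injective _ (hy.trans (map_zero _).symm)
      · intro x hx a y hy
        rw [AddSubgroup.mem_bot] at hx
        rw [hx, map_zero, zero_mul] at hy
        exact DirectSum.of_injective _ (hy.trans (map_zero _).symm)
      · intro i j hi hj hij
        omega
    rw [AddSubgroup.mem_bot] at h1
    rw [h1]
    exact zero_mem _

omit [DirectSum.GRing A] [∀ e, AddCommGroup (A e)] in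
-- This identity exhibits the cone monomial of degree n + 1 as the twisted product of those of
-- degrees 1 and n.
lemma typeExponent_add_smul {n : ℕ} :
    typeExponent p (coneType Δ) + p • typeExponent (p ^ n) (coneType Δ) =
      typeExponent (p ^ (n + 1)) (coneType Δ) := by
  ext i
  simp only [Finsupp.add_apply, Finsupp.smul_apply, typeExponent_apply, smul_eq_mul, coneType]
  have h1 : 0 < p := (Fact.out : p.Prime).pos
  have h2 := Nat.mul_le_mul_left p (Nat.one_le_pow n p h1)
  split_ifs
  · rfl
  · change p - 1 + p * (p ^ n - 1) = p ^ (n + 1) - 1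
    rw [pow_succ', Nat.mul_sub]
    omega

variable [CharP k p]

/-- Coefficients at proper exponents vanish on products of two factors of positive degree by
`add_smul_ne_typeExponent`. Factors of degree zero, on either side, only scale them, because these
exponents are minimal. -/
lemma decomposableSucc_le_ker {n : ℕ} (hsub : properTypes Δ ⊆ minGoodTypes Δ) :
    decomposableSucc A n ≤ LinearMap.ker
      (M.coeffMap h0 (Nat.succ_ne_zero n) (properTypes Δ) hsub) := by
  classical
  have hker : ∀ {x : A (n + 1)} {f}, M.Rel (n + 1) f x →
      (x ∈ LinearMap.ker (M.coeffMap h0 (Nat.succ_ne_zero n) (properTypes Δ) hsub) ↔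
        ∀ τ ∈ properTypes Δ, coeff (typeExponent (p ^ (n + 1)) τ) f = 0) := by
    intro x f hf
    rw [LinearMap.mem_ker]
    constructor
    · intro h τ hτ
      rw [← M.coeffMap_apply h0 (Nat.succ_ne_zero n) hsub hf ⟨τ, hτ⟩, h]
      rfl
    · intro h
      ext τ
      rw [M.coeffMap_apply h0 (Nat.succ_ne_zero n) hsub hf τ]
      exact h τ.1 τ.2
  have hmin : ∀ τ ∈ properTypes Δ, ∀ {x : A (n + 1)} {f}, M.Rel (n + 1) f x → ∀ r,
      coeff (typeExponent (p ^ (n + 1)) τ) (r * f) =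
        constantCoeff r * coeff (typeExponent (p ^ (n + 1)) τ) f := fun τ hτ x f hf r =>
    coeff_mul_of_minimal (M.mem_stable hf) r fun j hj hj' =>
      eq_typeExponent_of_le (two_le_pow (Nat.succ_ne_zero n)) (mem_properTypes.1 hτ).2 hj hj'
  intro x hx
  refine mem_of_mem_decomposableSucc (LinearMap.ker
      (M.coeffMap h0 (Nat.succ_ne_zero n) (properTypes Δ) hsub)).toAddSubgroup ?_ ?_ ?_ hx
  · intro a x hx y hy
    have hx' := (hker (M.rel_repr x)).1 hx
    refine (hker (M.mul (zero_add _) (M.rel_repr a) (M.rel_repr x) hy)).2 fun τ hτ => ?_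
    rw [pow_zero, pow_one, hmin τ hτ (M.rel_repr x), hx' τ hτ, mul_zero]
  · intro x hx a y hy
    have hx' := (hker (M.rel_repr x)).1 hx
    refine (hker (M.mul (add_zero _) (M.rel_repr x) (M.rel_repr a) hy)).2 fun τ hτ => ?_
    -- A degree zero factor on the right enters as a p-power of its series; only its constant term
    -- matters.
    rw [mul_comm, hmin τ hτ (M.rel_repr x), hx' τ hτ, mul_zero]
  · intro i j hi hj hij x y z hz
    refine (hker (M.mul hij (M.rel_repr x) (M.rel_repr y) hz)).2 fun τ hτ => ?_
    rw [coeff_mul]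
    refine Finset.sum_eq_zero fun uv huv => ?_
    by_contra hne
    obtain ⟨v, hv, hv0⟩ := InversePolynomial.exists_eq_smul_of_coeff_pow_ne_zero p i _ _
      (right_ne_zero_of_mul hne)
    refine add_smul_ne_typeExponent h0 (two_le_pow hi.ne') (two_le_pow hj.ne') hτ
      (M.mem_stable (M.rel_repr x) _ (left_ne_zero_of_mul hne))
      (M.mem_stable (M.rel_repr y) _ hv0) ?_
    rw [← hv, ← pow_add, hij]
    exact Finset.HasAntidiagonal.mem_antidiagonal.1 huv

omit [CharP k p] in
include M h0 in
lemma mem_decomposableSucc_of_rel_coneType {n : ℕ} {x : A (n + 1 + 1)}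
    (hx : M.Rel (n + 1 + 1) (monomial (typeExponent (p ^ (n + 1 + 1)) (coneType Δ)) 1) x) :
    x ∈ decomposableSucc A (n + 1) := by
  have hcone := coneType_mem_minGoodTypes h0
  obtain ⟨a, ha⟩ := M.exists_generators one_ne_zero
  obtain ⟨b, hb⟩ := M.exists_generators (Nat.succ_ne_zero n)
  have hcast : ∀ {s : ℕ} (_ : s = n + 1 + 1) (z : A s),
      ∃ z', DirectSum.of A (n + 1 + 1) z' = DirectSum.of A s z := by
    rintro _ rfl z
    exact ⟨z, rfl⟩
  obtain ⟨z, hz⟩ := hcast (add_comm 1 (n + 1))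
    (GradedMonoid.GMul.mul (a ⟨_, hcone⟩) (b ⟨_, hcone⟩))
  rw [← DirectSum.of_mul_of] at hz
  have h1 := M.mul (add_comm 1 (n + 1)) (ha _) (hb _) hz
  rw [monomial_pow, one_pow, monomial_mul_monomial, one_mul, pow_one,
    typeExponent_add_smul] at h1
  rw [M.ext hx h1]
  exact mem_decomposableSucc_of_eq_mul (Nat.succ_le_succ (Nat.zero_le n)) le_rfl hz

omit [CharP k p] in
include M h0 in
lemma span_sup_decomposableSucc {n : ℕ} {v : minGoodTypes Δ → A (n + 1 + 1)}
    (hv : ∀ τ, M.Rel (n + 1 + 1) (monomial (typeExponent (p ^ (n + 1 + 1)) τ.1) 1) (v τ))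
    (hsub : properTypes Δ ⊆ minGoodTypes Δ) :
    Submodule.span (A 0) (Set.range fun τ : properTypes Δ => v ⟨τ.1, hsub τ.2⟩) ⊔
      decomposableSucc A (n + 1) = ⊤ := by
  rw [eq_top_iff, ← M.span_generators (Nat.succ_ne_zero _) hv, Submodule.span_le]
  rintro _ ⟨τ, rfl⟩
  by_cases h : τ.1 = coneType Δ
  · refine Submodule.mem_sup_right (M.mem_decomposableSucc_of_rel_coneType h0 ?_)
    rw [← h]
    exact hv τ
  · exact Submodule.mem_sup_left (Submodule.subset_span
      ⟨⟨τ.1, mem_properTypes.2 ⟨h, mem_minGoodTypes.1 τ.2⟩⟩, rfl⟩)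

include M h0 in
lemma complexitySeq_add_two (n : ℕ) :
    complexitySeq A (n + 1 + 1) = (properTypes Δ).card := by
  classical
  have : RingHomSurjective (M.residue h0) := ⟨M.residue_surjective h0⟩
  have hsub : properTypes Δ ⊆ minGoodTypes Δ := Finset.erase_subset _ _
  have hne : n + 1 + 1 ≠ 0 := Nat.succ_ne_zero _
  obtain ⟨v, hv⟩ := M.exists_generators hne
  have h1 : Submodule.span (A 0) (Set.range fun τ : properTypes Δ => v ⟨τ.1, hsub τ.2⟩) ⊔
      decomposable A (n + 1 + 1) = ⊤ := M.span_sup_decomposableSucc h0 hv hsub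
  have h2 : decomposable A (n + 1 + 1) ≤
      LinearMap.ker (M.coeffMap h0 hne (properTypes Δ) hsub) := M.decomposableSucc_le_ker h0 hsub
  have h3 := complexitySeq_eq_card (M.residue h0) (M.coeffMap h0 hne _ hsub)
    (fun τ => v ⟨τ.1, hsub τ.2⟩) h1
    (fun τ => M.coeffMap_of_monomial h0 hne hsub τ (hv ⟨τ.1, hsub τ.2⟩)) h2
  rw [h3, Fintype.card_coe]

end PowerSeriesModel

/-- The Frobenius algebra of a module isomorphic to the inverse polynomials annihilated by a
squarefree monomial ideal is described by power series. -/
noncomputable def frobeniusModel {k : Type u} [Field k] (p : ℕ) [Fact p.Prime] [CharP k p] {m : ℕ}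
    {I : Ideal (MvPowerSeries (Fin m) k)} {Δ : LowerSet (Finset (Fin m))}
    (hI : I = supportIdeal k (nonfaceExponents Δ))
    {E : Type u} [AddCommGroup E] [Module (MvPowerSeries (Fin m) k ⧸ I) E]
    (w : E ≃ₗ[MvPowerSeries (Fin m) k ⧸ I] InversePolynomial.annihilatedBy I) :
    PowerSeriesModel k p Δ (FrobeniusAlgebra (MvPowerSeries (Fin m) k ⧸ I) p E) where
  Rel e f x := InversePolynomial.Represents w p e f (x : AddMonoid.End E)
  add := InversePolynomial.Represents.add
  mul := by
    intro e e' n f g x y z hn hx hy hz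
    subst hn
    have h := congrArg
      (DirectSum.coeRingHom (frobeniusOperators (MvPowerSeries (Fin m) k ⧸ I) p E)) hz
    rw [map_mul] at h
    have h' : (z : AddMonoid.End E) = x * y := by
      refine ((DirectSum.coeRingHom_of _ _ _).symm.trans h).trans ?_
      exact congrArg₂ (· * ·) (DirectSum.coeRingHom_of _ _ _) (DirectSum.coeRingHom_of _ _ _)
    rw [h']
    exact hx.mul hy
  one := fun x => by
    change (w x : InversePolynomial k m) = _
    rw [one_smul]
    generalize (w x : InversePolynomial k m) = d
    induction d using Finsupp.induction_linear with
    | zero => simp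
    | add d d' h h' => rw [map_add, ← h, ← h']
    | single b c =>
      rw [InversePolynomial.frob_single, pow_zero, pow_one]
      congr 1
      ext i
      simp
  ext := fun hx hy => Subtype.ext (hx.ext hy)
  sub_mem := fun hf hg => hf.sub_mem hI hg
  of_sub_mem := fun hf hg => hf.of_sub_mem hI hg
  mem_stable := fun hf => hf.mem_stable hI
  exists_rel := fun x => InversePolynomial.exists_represents w p hI _ x
  exists_of_mem_stable := fun hf => InversePolynomial.exists_operator w p hI hf

theorem mainTheorem5 {k : Type u} [Field k] (p : ℕ) [Fact p.Prime] [CharP k p] (m : ℕ)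
    (I : Ideal (MvPowerSeries (Fin m) k)) (hI : IsSquarefreeMonomialIdeal I)
    [Nontrivial (MvPowerSeries (Fin m) k ⧸ I)]
    {E : Type u} [AddCommGroup E] [Module (MvPowerSeries (Fin m) k ⧸ I) E]
    (ι : IsLocalRing.ResidueField (MvPowerSeries (Fin m) k ⧸ I)
      →ₗ[MvPowerSeries (Fin m) k ⧸ I] E)
    (hι : IsInjectiveHull ι)
    (hinf : ¬ GradedComplexity.IsFinitelyGenerated
      (FrobeniusAlgebra (MvPowerSeries (Fin m) k ⧸ I) p E))
    (μ : ℕ) (hμ : μ = (idealJ I p).spanFinrank) :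
    GradedComplexity.IsDegreewiseFinite
        (FrobeniusAlgebra (MvPowerSeries (Fin m) k ⧸ I) p E) ∧
      (GradedComplexity.complexitySeq (FrobeniusAlgebra (MvPowerSeries (Fin m) k ⧸ I) p E) 0 = 1 ∧
        GradedComplexity.complexitySeq
          (FrobeniusAlgebra (MvPowerSeries (Fin m) k ⧸ I) p E) 1 = μ + 1 ∧
        ∀ e, 2 ≤ e → GradedComplexity.complexitySeq
          (FrobeniusAlgebra (MvPowerSeries (Fin m) k ⧸ I) p E) e = μ) ∧
      GradedComplexity.generatingFunction
          (FrobeniusAlgebra (MvPowerSeries (Fin m) k ⧸ I) p E) =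
        (1 + (μ : PowerSeries ℚ) * PowerSeries.X - PowerSeries.X ^ 2) *
          (1 - PowerSeries.X)⁻¹ ∧
      GradedComplexity.complexity (FrobeniusAlgebra (MvPowerSeries (Fin m) k ⧸ I) p E) = 1 ∧
      frobeniusComplexity (MvPowerSeries (Fin m) k ⧸ I) p E = 0 := by
  classical
  obtain ⟨w⟩ := hι.nonempty_linearEquiv (InversePolynomial.isInjectiveHull_residueEmbedding I)
  have h0 := empty_mem_stanleyReisnerComplex I
  have M := frobeniusModel p hI.eq_supportIdeal w
  rw [spanFinrank_idealJ hI p] at hμ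
  have hfin := M.isDegreewiseFinite
  have hc0 := M.complexitySeq_zero h0
  have hc1 : GradedComplexity.complexitySeq
      (FrobeniusAlgebra (MvPowerSeries (Fin m) k ⧸ I) p E) 1 = μ + 1 := by
    rw [M.complexitySeq_one h0, hμ, properTypes,
      Finset.card_erase_add_one (coneType_mem_minGoodTypes h0)]
  have hc2 : ∀ e, 2 ≤ e → GradedComplexity.complexitySeq
      (FrobeniusAlgebra (MvPowerSeries (Fin m) k ⧸ I) p E) e = μ := by
    intro e he
    obtain ⟨n, rfl⟩ := Nat.exists_eq_add_of_le' he
    rw [hμ]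
    exact M.complexitySeq_add_two h0 n
  -- With μ = 0 there would be no new generators from degree two on, contradicting the failure of
  -- finite generation.
  have hμ0 : μ ≠ 0 := by
    rintro rfl
    exact hinf (GradedComplexity.isFinitelyGenerated_of_complexitySeq_eq_zero hfin hc2)
  have hcx := GradedComplexity.complexity_eq_one hμ0 hc2
  refine ⟨hfin, ⟨hc0, hc1, hc2⟩, GradedComplexity.generatingFunction_eq hc0 hc1 hc2, hcx, ?_⟩
  rw [frobeniusComplexity, hcx, ENNReal.log_one, EReal.zero_div]
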